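/- Let $V$ be a real separable Banach space, $T\ge 0$ an integer and $I=\{0,1,\dots,T\}$. An adapted process $\mathbf X=(\Omega,\mathbb P,(\mathcal F_t)_{t\in I},X)\in\mathcal S(V)$ consists of a filtered probability space and random variables $X_t:\Omega\to V$, $t\in I$, with $X_t$ $\mathcal F_t$-measurable; different processes may live on different spaces. *Adapted functionals.* They are the maps $f$, sending each $\mathbf X\in\mathcal S(V)$ to a real random variable $f(\mathbf X)$, that are generated by the following rules: (a) $\mathbf X\mapsto g(X_{t_1},\dots,X_{t_n})$ with $t_i\in I$, $g\in C_b(V^n,\mathbb R)$, of rank $0$; (b) $\mathbf X\mapsto g(f_1(\mathbf X),\dots,f_n(\mathbf X))$ with $g\in C_b(\mathbb R^n,\mathbb R)$, of rank $\max_i\operatorname{rank}f_i$; (c) $\mathbf X\mapsto\mathbb E[f(\mathbf X)\mid\mathcal F_t]$ with $t\in I$, of rank $\operatorname{rank}f+1$. $\mathrm{AF}_r$ is the set of those that have a construction of rank at most $r$. *Prediction processes.* Put $\mathrm{Prob}_0(V)=V$ and $\mathrm{Prob}_{r+1}(V)=\mathrm{Prob}(I\to\mathrm{Prob}_r(V))$,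 with the weak topologies and their Borel $\sigma$-algebras. Let $\hat X^0=X$ and $\hat X^{r+1}_t=\mathbb P(\hat X^r\in\cdot\mid\mathcal F_t)$ (regular conditional distribution), so that $\operatorname{Law}(\hat X^r)\in\mathrm{Prob}_{r+1}(V)$. *Signatures.* For a Banach space $E$ give $\mathbb R\oplus E$ the norm $|s|+\|v\|$, and let its algebraic tensor powers carry admissible norms, i.e. norms that extend $|\cdot|$ in degree $0$ and the given norm in degree $1$, are invariant under permutation of the factors of elementary tensors, satisfy $\|s\otimes t\|\le\|s\|\,\|t\|$, and make all products $\ell_1\otimes\cdots\otimes\ell_m$ of continuous linear functionals continuous (for example the projective or the injective norms). Let $\mathbf T(E)$ be the completion of $\bigoplus_{m\ge0}(\mathbb R\oplus E)^{\otimes m}$ under $\|t\|=\sum_m\|t_m\|$. The signature of $x:I\to E$ is $S(x)=\exp(\Delta_0x)\cdot\exp(\Delta_1x)\cdots\exp(\Delta_Tx)\in\mathbf T(E)$, where $\exp(v)=(v^{\otimes m}/m!)_{m\ge0}$, $(s\cdot t)_m=\sum_{i+j=m}s_i\otimes t_j$, $\Delta_0x=(1,x(0))$ and $\Delta_tx=(1,x(t)-x(t-1))$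 for $t\ge1$. A tensor normalization on $\mathbf T(E)$ is a bounded, continuous, injective map $\Lambda:\{t\in\mathbf T(E):t_0=1\}\to\mathbf T(E)$ of the form $\Lambda(t)=(\lambda(t)^mt_m)_{m\ge0}$ with $\lambda(t)\in(0,\infty)$. Let $\mathbf T^0(V)=V$ and $\mathbf T^{r+1}(V)=\mathbf T(\mathbf T^r(V))$, and fix any tensor normalization $\Lambda_{r}$ on each $\mathbf T(\mathbf T^{r}(V))$, $r\ge0$. The robust expected signatures $\bar S^r:\mathrm{Prob}_r(V)\to\mathbf T^r(V)$ are $\bar S^0=\mathrm{id}_V$ and the Bochner integrals $$\bar S^{r+1}(\mu)=\int\Lambda_r\big(S(t\mapsto\bar S^r(x(t)))\big)\,\mu(dx).$$ Finally let $\Phi_r(\mathbf X)=\bar S^{r+1}(\operatorname{Law}(\hat X^r))\in\mathbf T^{r+1}(V)$. **Theorem.** For any such choice of admissible norms and tensor normalizations, all $\mathbf X,\mathbf Y\in\mathcal S(V)$ and every $r\ge0$, the following are equivalent: 1. $\mathbb E[f(\mathbf X)]=\mathbb E[f(\mathbf Y)]$ for all $f\in\mathrm{AF}_r$; 2. $\operatorname{Law}(\hat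 X^r)=\operatorname{Law}(\hat Y^r)$; 3. $\operatorname{Law}(\hat X^0,\dots,\hat X^r)=\operatorname{Law}(\hat Y^0,\dots,\hat Y^r)$; 4. $\Phi_r(\mathbf X)=\Phi_r(\mathbf Y)$. -/

import Mathlib

open MeasureTheory ProbabilityTheory Set Filter Topology
open scoped TensorProduct BoundedContinuousFunction

universe u v w

noncomputable section

/-! ### Probability measures on a standard Borel space form a standard Borel space -/

theorem standardBorelSpace_of_measurableEquiv {α β : Type*} [MeasurableSpace α] [MeasurableSpace β]
    [h : StandardBorelSpace β] (e : α ≃ᵐ β) : StandardBorelSpace α := by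
  obtain ⟨τ, hb, hp⟩ := h.polish
  refine ⟨⟨TopologicalSpace.induced e τ, ?_, ?_⟩⟩
  · refine @BorelSpace.mk _ (_) _ ?_
    rw [borel_comap, ← hb.measurable_eq]
    exact e.measurableEmbedding.comap_eq.symm
  · exact e.toEquiv.polishSpace_induced

open scoped Classical in
theorem standardBorelSpace_probabilityMeasure (α : Type*) [MeasurableSpace α]
    [StandardBorelSpace α] [Nonempty α] : StandardBorelSpace (ProbabilityMeasure α) := by
  have he := measurableEmbedding_embeddingReal α
  set e := embeddingReal α with he_def
  let F : ProbabilityMeasure α → ℚ → ℝ := fun μ q ↦ (μ : Measure α).real (e ⁻¹' Iic (q : ℝ))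
  have hF : Measurable F := by
    refine measurable_pi_lambda _ fun q ↦ ?_
    exact ((Measure.measurable_coe (he.measurable measurableSet_Iic)).comp
      measurable_subtype_coe).ennreal_toReal
  let S : (ℚ → ℝ) → Measure ℝ := fun f ↦ (stieltjesOfMeasurableRat id measurable_id f).measure
  have hS : Measurable S := measurable_measure_stieltjesOfMeasurableRat measurable_id
  let C : (ℚ → ℝ) → Measure α := fun f ↦ (S f).comap e
  have hC : Measurable C := by
    refine Measure.measurable_of_measurable_coe _ fun s hs ↦ ?_
    simp only [C, he.comap_apply]
    exact (Measure.measurable_coe (he.measurableSet_image.2 hs)).comp hS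
  have hP : MeasurableSet {f | IsProbabilityMeasure (C f)} :=
    hC ProbabilityMeasure.measurableSet_isProbabilityMeasure
  let x₀ : α := Classical.arbitrary α
  let G₀ : (ℚ → ℝ) → Measure α := fun f ↦ if IsProbabilityMeasure (C f) then C f else Measure.dirac x₀
  have hG₀p : ∀ f, IsProbabilityMeasure (G₀ f) := by
    intro f
    simp only [G₀]
    split_ifs with h
    · exact h
    · infer_instance
  have hG₀ : Measurable G₀ := Measurable.ite hP hC measurable_const
  let G : (ℚ → ℝ) → ProbabilityMeasure α := fun f ↦ ⟨G₀ f, hG₀p f⟩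
  have hG : Measurable G := hG₀.subtype_mk
  have hGF : Function.LeftInverse G F := by
    intro μ
    let ν : Measure ℝ := (μ : Measure α).map e
    have hν : IsProbabilityMeasure ν := Measure.isProbabilityMeasure_map he.measurable.aemeasurable
    have hFc : ∀ q : ℚ, F μ q = cdf ν q := by
      intro q
      rw [cdf_eq_real, measureReal_def, he.map_apply, ← measureReal_def]
    have hpt : IsRatStieltjesPoint (id : (ℚ → ℝ) → ℚ → ℝ) (F μ) := by
      refine ⟨?_, ?_, ?_, ?_⟩
      · intro a b hab
        simp only [id, hFc]
        exact monotone_cdf ν (by exact_mod_cast hab)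
      · have : (id (F μ) : ℚ → ℝ) = fun q : ℚ ↦ cdf ν q := funext hFc
        rw [this]
        exact (tendsto_cdf_atTop ν).comp (tendsto_ratCast_atTop_iff.2 tendsto_id)
      · have : (id (F μ) : ℚ → ℝ) = fun q : ℚ ↦ cdf ν q := funext hFc
        rw [this]
        exact (tendsto_cdf_atBot ν).comp (tendsto_ratCast_atBot_iff.2 tendsto_id)
      · intro t
        simp only [id, hFc]
        rw [← StieltjesFunction.iInf_rat_gt_eq (cdf ν) (t : ℝ)]
        refine Equiv.iInf_congr (Equiv.subtypeEquivRight fun q ↦ ?_) fun q ↦ rfl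
        exact Rat.cast_lt.symm
    have hSν : S (F μ) = ν := by
      refine ext_of_generate_finite _ (BorelSpace.measurable_eq.trans
        Real.borel_eq_generateFrom_Iic_rat) Real.isPiSystem_Iic_rat ?_ ?_
      · intro s hs
        obtain ⟨q, rfl⟩ := mem_iUnion.1 hs
        simp only [S]
        rw [measure_stieltjesOfMeasurableRat_Iic, stieltjesOfMeasurableRat_eq,
          toRatCDF_of_isRatStieltjesPoint hpt, id, hFc, ofReal_cdf]
      · simp [S]
    have hCμ : C (F μ) = μ := by
      simp only [C, hSν]
      exact he.comap_map _
    apply Subtype.ext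
    change G₀ (F μ) = μ
    have hp : IsProbabilityMeasure (C (F μ)) := hCμ ▸ μ.2
    simp only [G₀, if_pos hp, hCμ]
  have hr : MeasurableSet (range F) := by
    have : range F = {f | F (G f) = f} := by
      ext f
      constructor
      · rintro ⟨μ, rfl⟩
        exact congrArg F (hGF μ)
      · intro h
        exact ⟨G f, h⟩
    rw [this]
    exact measurableSet_eq_fun (hF.comp hG) measurable_id
  have hE : MeasurableEmbedding F := .of_measurable_inverse hF hr hG hGF
  have := hr.standardBorel
  exact standardBorelSpace_of_measurableEquiv hE.equivRange

/-! ### Adapted processes -/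

/-- An adapted stochastic process in discrete time `{0, …, T}` with state space `U`: a filtered
probability space together with an adapted family of random variables. -/
structure AdaptedProcess (T : ℕ) (U : Type u) [MeasurableSpace U] where
  Ω : Type v
  mΩ : MeasurableSpace Ω
  P : Measure Ω
  isProbabilityMeasure : IsProbabilityMeasure P
  ℱ : Filtration (Fin (T + 1)) mΩ
  X : Fin (T + 1) → Ω → U
  adapted : ∀ t, Measurable[ℱ t] (X t)

attribute [instance] AdaptedProcess.mΩ AdaptedProcess.isProbabilityMeasure

/-! ### Adapted functionals -/

/-- Adapted functionals, given by their construction: bounded continuous functions of finitely many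
marginals, bounded continuous functions of finitely many adapted functionals, and conditional
expectations of adapted functionals. -/
inductive AdaptedFunctional (T : ℕ) (U : Type u) [TopologicalSpace U] : Type u
  | marginal (n : ℕ) (t : Fin n → Fin (T + 1)) (g : (Fin n → U) →ᵇ ℝ) : AdaptedFunctional T U
  | comp (n : ℕ) (g : (Fin n → ℝ) →ᵇ ℝ) (f : Fin n → AdaptedFunctional T U) :
      AdaptedFunctional T U
  | condExp (t : Fin (T + 1)) (f : AdaptedFunctional T U) : AdaptedFunctional T U

namespace AdaptedFunctional

variable {T : ℕ} {U : Type u} [TopologicalSpace U]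

/-- The number of nested conditional expectations. -/
def rank : AdaptedFunctional T U → ℕ
  | marginal _ _ _ => 0
  | comp _ _ f => Finset.univ.sup fun i => (f i).rank
  | condExp _ f => f.rank + 1

/-- The random variable `f(X)`, well defined up to almost sure equality. -/
def eval [MeasurableSpace U] (X : AdaptedProcess.{u, v} T U) :
    AdaptedFunctional T U → X.Ω → ℝ
  | marginal _ t g => fun ω => g fun i => X.X (t i) ω
  | comp _ g f => fun ω => g fun i => (f i).eval X ω
  | condExp t f => X.P[f.eval X | X.ℱ t]

end AdaptedFunctional

/-! ### Probability measures of higher rank and prediction processes -/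

section Prediction

variable (T : ℕ) (V : Type u) [MeasurableSpace V]

/-- Recursive construction of `RankProb` together with its σ-algebra. -/
def rankProbAux : ℕ → Σ α : Type u, MeasurableSpace α
  | 0 => ⟨V, inferInstance⟩
  | r + 1 =>
    letI : MeasurableSpace (rankProbAux r).1 := (rankProbAux r).2
    ⟨ProbabilityMeasure (Fin (T + 1) → (rankProbAux r).1), inferInstance⟩

/-- Rank `r` probability measures on `V`: `Prob_0(V) = V` and
`Prob_{r+1}(V) = Prob({0,…,T} → Prob_r(V))`. -/
def RankProb (r : ℕ) : Type u := (rankProbAux T V r).1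

/-- The σ-algebra on `Prob_{r+1}(V)` is generated by the evaluations `μ ↦ μ(B)`, `B` measurable;
for Polish `V` it is the Borel σ-algebra of the weak topology. -/
instance (r : ℕ) : MeasurableSpace (RankProb T V r) := (rankProbAux T V r).2

theorem rankProb_succ (r : ℕ) :
    RankProb T V (r + 1) = ProbabilityMeasure (Fin (T + 1) → RankProb T V r) := rfl

variable [StandardBorelSpace V] [Nonempty V]

theorem rankProb_nonempty_and_standardBorel (r : ℕ) :
    Nonempty (RankProb T V r) ∧ StandardBorelSpace (RankProb T V r) := by
  induction r with
  | zero => exact ⟨‹Nonempty V›, ‹StandardBorelSpace V›⟩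
  | succ r ih =>
    obtain ⟨h1, h2⟩ := ih
    refine ⟨?_, standardBorelSpace_probabilityMeasure (Fin (T + 1) → RankProb T V r)⟩
    exact ⟨(⟨Measure.dirac (Classical.arbitrary _), inferInstance⟩ :
      ProbabilityMeasure (Fin (T + 1) → RankProb T V r))⟩

instance (r : ℕ) : Nonempty (RankProb T V r) := (rankProb_nonempty_and_standardBorel T V r).1

instance (r : ℕ) : StandardBorelSpace (RankProb T V r) :=
  (rankProb_nonempty_and_standardBorel T V r).2

end Prediction

/-- The regular conditional distribution `P(Y ∈ · | m)`, as a random probability measure. -/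
def condLaw {Ω E : Type*} [mΩ : MeasurableSpace Ω] [MeasurableSpace E] [StandardBorelSpace E]
    [Nonempty E] (P : Measure Ω) [IsProbabilityMeasure P] (m : MeasurableSpace Ω) (Y : Ω → E)
    (ω : Ω) : ProbabilityMeasure E :=
  ⟨@condDistrib Ω Ω E _ _ _ mΩ m Y id P _ ω, inferInstance⟩

theorem measurable_condLaw {Ω E : Type*} [mΩ : MeasurableSpace Ω] [MeasurableSpace E]
    [StandardBorelSpace E] [Nonempty E] (P : Measure Ω) [IsProbabilityMeasure P]
    (m : MeasurableSpace Ω) (Y : Ω → E) : Measurable[m] (condLaw (mΩ := mΩ) P m Y) :=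
  @Measurable.subtype_mk Ω (Measure E) m _ _ _
    (@Kernel.measurable Ω E m _ (@condDistrib Ω Ω E _ _ _ mΩ m Y id P _)) _

namespace AdaptedProcess

variable {T : ℕ} {V : Type u} [MeasurableSpace V] [StandardBorelSpace V] [Nonempty V]

/-- The rank `r` prediction process. -/
def prediction (X : AdaptedProcess.{u, v} T V) :
    (r : ℕ) → X.Ω → Fin (T + 1) → RankProb T V r
  | 0 => fun ω t => X.X t ω
  | r + 1 => fun ω t =>
    (condLaw X.P (X.ℱ t) (X.prediction r) ω :
      ProbabilityMeasure (Fin (T + 1) → RankProb T V r))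

theorem measurable_prediction (X : AdaptedProcess.{u, v} T V) (r : ℕ) :
    Measurable (X.prediction r) := by
  refine measurable_pi_lambda _ fun t => ?_
  cases r with
  | zero => exact (X.adapted t).mono (X.ℱ.le t) le_rfl
  | succ r => exact (measurable_condLaw X.P (X.ℱ t) (X.prediction r)).mono (X.ℱ.le t) le_rfl

/-- The law of the rank `r` prediction process, an element of `Prob_{r+1}(V)`. -/
def predictionLaw (X : AdaptedProcess.{u, v} T V) (r : ℕ) : RankProb T V (r + 1) :=
  (⟨X.P.map (X.prediction r),
    Measure.isProbabilityMeasure_map (X.measurable_prediction r).aemeasurable⟩ :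
    ProbabilityMeasure (Fin (T + 1) → RankProb T V r))

/-- The joint law of the prediction processes of ranks `0, …, r`. -/
def jointPredictionLaw (X : AdaptedProcess.{u, v} T V) (r : ℕ) :
    Measure ((i : Fin (r + 1)) → Fin (T + 1) → RankProb T V i) :=
  X.P.map fun ω i => X.prediction i ω

end AdaptedProcess

/-! ### Tensor sequences: exponential, convolution product, discrete signature -/

section TensorSequences

variable {F : Type*} [AddCommGroup F] [Module ℝ F]

/-- The unit of `∏ₘ F^{⊗m}`. -/
def tensorOne : (m : ℕ) → ⨂[ℝ]^m F
  | 0 => PiTensorProduct.tprod ℝ Fin.elim0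
  | _ + 1 => 0

/-- The tensor exponential `(v^{⊗m} / m!)ₘ`. -/
def tensorExp (v : F) (m : ℕ) : ⨂[ℝ]^m F :=
  (m.factorial : ℝ)⁻¹ • PiTensorProduct.tprod ℝ fun _ : Fin m => v

/-- The tensor convolution product `(s · t)ₘ = ∑_{i+j=m} sᵢ ⊗ tⱼ`. -/
def tensorConv (s t : (m : ℕ) → ⨂[ℝ]^m F) (m : ℕ) : ⨂[ℝ]^m F :=
  ∑ p ∈ (Finset.HasAntidiagonal.antidiagonal m).attach,
    TensorPower.cast ℝ F (Finset.HasAntidiagonal.mem_antidiagonal.1 p.2)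
      (GradedMonoid.GMul.mul (A := fun i => ⨂[ℝ]^i F) (s p.1.1) (t p.1.2))

end TensorSequences

/-- The direct sum `ℝ ⊕ E` with norm `|s| + ‖v‖`. -/
abbrev TimeExt (E : Type*) : Type _ := WithLp 1 (ℝ × E)

/-- Increments of the time-extended path: `Δ₀x = (1, x(0))`, `Δₜx = (1, x(t) - x(t-1))`. -/
def timeIncrement {T : ℕ} {E : Type*} [NormedAddCommGroup E] (x : Fin (T + 1) → E)
    (t : Fin (T + 1)) : TimeExt E :=
  WithLp.toLp 1
    ((1 : ℝ), Fin.cases (motive := fun _ => E) (x 0) (fun s => x s.succ - x s.castSucc) t)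

/-- The discrete signature `exp(Δ₀x) · exp(Δ₁x) ⋯ exp(Δ_T x)`, as a sequence of tensors. -/
def signatureSeq {T : ℕ} {E : Type*} [NormedAddCommGroup E] [NormedSpace ℝ E]
    (x : Fin (T + 1) → E) : (m : ℕ) → ⨂[ℝ]^m (TimeExt E) :=
  (List.ofFn fun t => tensorExp (timeIncrement x t)).foldr tensorConv tensorOne

/-! ### Norms on tensor powers and the completed tensor algebra -/

/-- Admissible norms on the tensor powers of a normed space: they are invariant under permutation
of the factors of an elementary tensor and submultiplicative, agree with the given norm in degree
one (and with the absolute value in degree zero), and the products `ℓ₁ ⊗ ⋯ ⊗ ℓₘ` of continuous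
functionals are continuous. As the latter separate points, each `norm m` is positive definite. -/
structure AdmissibleNorm (F : Type*) [NormedAddCommGroup F] [NormedSpace ℝ F] where
  norm : (m : ℕ) → Seminorm ℝ (⨂[ℝ]^m F)
  norm_unit : norm 0 (PiTensorProduct.tprod ℝ Fin.elim0) = 1
  norm_single : ∀ v : F, norm 1 (PiTensorProduct.tprod ℝ fun _ => v) = ‖v‖
  norm_perm : ∀ (m : ℕ) (σ : Equiv.Perm (Fin m)) (v : Fin m → F),
    norm m (PiTensorProduct.tprod ℝ fun i => v (σ i)) = norm m (PiTensorProduct.tprod ℝ v)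
  norm_mul_le : ∀ (m n : ℕ) (s : ⨂[ℝ]^m F) (t : ⨂[ℝ]^n F),
    norm (m + n) (GradedMonoid.GMul.mul (A := fun i => ⨂[ℝ]^i F) s t) ≤ norm m s * norm n t
  continuous_functional : ∀ (m : ℕ) (ℓ : Fin m → StrongDual ℝ F), ∃ C : ℝ, ∀ t : ⨂[ℝ]^m F,
    |PiTensorProduct.lift ((MultilinearMap.mkPiAlgebra ℝ (Fin m) ℝ).compLinearMap
      fun i => (ℓ i).toLinearMap) t| ≤ C * norm m t

section CompletedTensorAlgebra

variable {F : Type u} [NormedAddCommGroup F] [NormedSpace ℝ F]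

/-- The algebraic tensor power `F^{⊗m}`, carrying the norm from `N`. -/
def NormedTensorPower (_N : AdmissibleNorm F) (m : ℕ) : Type u := ⨂[ℝ]^m F

instance (N : AdmissibleNorm F) (m : ℕ) : AddCommGroup (NormedTensorPower N m) :=
  inferInstanceAs (AddCommGroup (⨂[ℝ]^m F))

instance (N : AdmissibleNorm F) (m : ℕ) : Module ℝ (NormedTensorPower N m) :=
  inferInstanceAs (Module ℝ (⨂[ℝ]^m F))

instance (N : AdmissibleNorm F) (m : ℕ) : SeminormedAddCommGroup (NormedTensorPower N m) :=
  AddGroupSeminorm.toSeminormedAddCommGroup (E := NormedTensorPower N m)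
    (N.norm m).toAddGroupSeminorm

theorem NormedTensorPower.norm_def (N : AdmissibleNorm F) (m : ℕ) (t : NormedTensorPower N m) :
    ‖t‖ = N.norm m t := rfl

instance (N : AdmissibleNorm F) (m : ℕ) : NormedSpace ℝ (NormedTensorPower N m) where
  norm_smul_le c t := (map_smul_eq_mul (N.norm m) c t).le

/-- The completed tensor power. -/
abbrev CompletedTensorPower (N : AdmissibleNorm F) (m : ℕ) : Type u :=
  UniformSpace.Completion (NormedTensorPower N m)

/-- An algebraic tensor, viewed in the completed tensor power. -/
def toCompletedTensorPower (N : AdmissibleNorm F) (m : ℕ) (t : ⨂[ℝ]^m F) :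
    CompletedTensorPower N m :=
  UniformSpace.Completion.coe' (α := NormedTensorPower N m) t

/-- The completion of `⨁ₘ F^{⊗m}` with respect to the norm `∑ₘ ‖tₘ‖`. -/
abbrev CompletedTensorAlgebra (N : AdmissibleNorm F) : Type u :=
  lp (fun m => CompletedTensorPower N m) 1

theorem norm_toCompletedTensorPower (N : AdmissibleNorm F) (m : ℕ) (t : ⨂[ℝ]^m F) :
    ‖toCompletedTensorPower N m t‖ = N.norm m t :=
  UniformSpace.Completion.norm_coe (E := NormedTensorPower N m) t

theorem AdmissibleNorm.norm_cast (N : AdmissibleNorm F) {i j : ℕ} (h : i = j) (t : ⨂[ℝ]^i F) :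
    N.norm j (TensorPower.cast ℝ F h t) = N.norm i t := by
  subst h
  simp

theorem AdmissibleNorm.norm_pow_le (N : AdmissibleNorm F) (v : F) (m : ℕ) :
    N.norm m (PiTensorProduct.tprod ℝ fun _ : Fin m => v) ≤ ‖v‖ ^ m := by
  induction m with
  | zero =>
    have : (fun _ : Fin 0 => v) = Fin.elim0 := funext fun i => i.elim0
    rw [this, N.norm_unit, pow_zero]
  | succ m ih =>
    have h : PiTensorProduct.tprod ℝ (fun _ : Fin (m + 1) => v) =
        GradedMonoid.GMul.mul (A := fun i => ⨂[ℝ]^i F)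
          (PiTensorProduct.tprod ℝ fun _ : Fin m => v)
          (PiTensorProduct.tprod ℝ fun _ : Fin 1 => v) := by
      rw [TensorPower.tprod_mul_tprod]
      congr 1
      funext i
      refine Fin.addCases (fun i => ?_) (fun i => ?_) i <;> simp
    rw [h, pow_succ]
    refine (N.norm_mul_le _ _ _ _).trans ?_
    rw [N.norm_single]
    exact mul_le_mul_of_nonneg_right ih (norm_nonneg v)

theorem AdmissibleNorm.summable_one (N : AdmissibleNorm F) :
    Summable fun m => N.norm m (tensorOne m) := by
  refine summable_of_ne_finset_zero (s := {0}) fun m hm => ?_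
  cases m with
  | zero => simp at hm
  | succ m => simp [tensorOne]

theorem AdmissibleNorm.summable_exp (N : AdmissibleNorm F) (v : F) :
    Summable fun m => N.norm m (tensorExp v m) := by
  refine Summable.of_nonneg_of_le (fun m => apply_nonneg _ _) (fun m => ?_)
    (Real.summable_pow_div_factorial ‖v‖)
  rw [tensorExp, map_smul_eq_mul, Real.norm_eq_abs, abs_of_nonneg (by positivity),
    div_eq_inv_mul]
  exact mul_le_mul_of_nonneg_left (N.norm_pow_le v m) (by positivity)

theorem AdmissibleNorm.summable_conv (N : AdmissibleNorm F) {s t : (m : ℕ) → ⨂[ℝ]^m F}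
    (hs : Summable fun m => N.norm m (s m)) (ht : Summable fun m => N.norm m (t m)) :
    Summable fun m => N.norm m (tensorConv s t m) := by
  have h := summable_sum_mul_antidiagonal_of_summable_norm'
    (f := fun m => N.norm m (s m)) (g := fun m => N.norm m (t m)) hs.norm hs ht.norm ht
  refine Summable.of_nonneg_of_le (fun m => apply_nonneg _ _) (fun m => ?_) h
  rw [tensorConv]
  conv_rhs => rw [← Finset.sum_attach]
  refine (Finset.le_sum_of_subadditive (N.norm m) (map_zero (N.norm m)).le
    (map_add_le_add (N.norm m)) _ _).trans (Finset.sum_le_sum fun p _ => ?_)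
  rw [N.norm_cast]
  exact N.norm_mul_le _ _ _ _

end CompletedTensorAlgebra

section Signature

variable {F : Type u} [NormedAddCommGroup F] [NormedSpace ℝ F]

theorem AdmissibleNorm.memℓp (N : AdmissibleNorm F) {s : (m : ℕ) → ⨂[ℝ]^m F}
    (hs : Summable fun m => N.norm m (s m)) :
    Memℓp (fun m => toCompletedTensorPower N m (s m)) 1 := by
  refine memℓp_gen ?_
  simpa [norm_toCompletedTensorPower] using hs

theorem AdmissibleNorm.summable_signatureSeq {T : ℕ} {E : Type u} [NormedAddCommGroup E]
    [NormedSpace ℝ E] (N : AdmissibleNorm (TimeExt E)) (x : Fin (T + 1) → E) :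
    Summable fun m => N.norm m (signatureSeq x m) := by
  have key : ∀ l : List (TimeExt E), Summable fun m =>
      N.norm m ((l.map tensorExp).foldr tensorConv tensorOne m) := by
    intro l
    induction l with
    | nil => exact N.summable_one
    | cons v l ih => exact N.summable_conv (N.summable_exp v) ih
  have h := key (List.ofFn (timeIncrement x))
  rwa [List.map_ofFn] at h

/-- The signature of a discrete-time path, in the completed tensor algebra over `ℝ ⊕ E`. -/
def signature {T : ℕ} {E : Type u} [NormedAddCommGroup E] [NormedSpace ℝ E]
    (N : AdmissibleNorm (TimeExt E)) (x : Fin (T + 1) → E) : CompletedTensorAlgebra N :=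
  ⟨fun m => toCompletedTensorPower N m (signatureSeq x m), N.memℓp (N.summable_signatureSeq x)⟩

/-- The elements of the completed tensor algebra with scalar component `1`. -/
def unitScalarPart (N : AdmissibleNorm F) : Set (CompletedTensorAlgebra N) :=
  {t | t 0 = toCompletedTensorPower N 0 (PiTensorProduct.tprod ℝ Fin.elim0)}

/-- A tensor normalization: a bounded, continuous, injective map `t ↦ δ_{λ(t)} t` with `λ(t) > 0`
on the tensors with scalar component `1`, where `δ_c` multiplies the `m`-th component by `c ^ m`.
Values of `toFun` and `scale` at other tensors are irrelevant. -/
structure TensorNormalization (N : AdmissibleNorm F) where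
  scale : CompletedTensorAlgebra N → ℝ
  toFun : CompletedTensorAlgebra N → CompletedTensorAlgebra N
  scale_pos : ∀ t ∈ unitScalarPart N, 0 < scale t
  apply_eq : ∀ t ∈ unitScalarPart N, ∀ m, toFun t m = scale t ^ m • t m
  bounded : ∃ K : ℝ, ∀ t ∈ unitScalarPart N, ‖toFun t‖ ≤ K
  continuousOn : ContinuousOn toFun (unitScalarPart N)
  injOn : InjOn toFun (unitScalarPart N)

end Signature

/-! ### Higher rank tensor algebras and robust expected signatures -/

/-- A choice of admissible tensor norms for every normed space. -/
abbrev TensorNormSystem : Type (u + 1) :=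
  (E : Type u) → [NormedAddCommGroup E] → [NormedSpace ℝ E] → AdmissibleNorm E

/-- A bundled real Banach space. -/
structure BanachBundle : Type (u + 1) where
  carrier : Type u
  [normed : NormedAddCommGroup carrier]
  [space : NormedSpace ℝ carrier]
  [complete : CompleteSpace carrier]

attribute [instance] BanachBundle.normed BanachBundle.space BanachBundle.complete

section HigherRank

variable (N : TensorNormSystem.{u}) (V : Type u) [NormedAddCommGroup V] [NormedSpace ℝ V]
  [CompleteSpace V]

/-- Recursive construction of `RankTensor` together with its norm. -/
def rankTensorAux : ℕ → BanachBundle.{u}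
  | 0 => ⟨V⟩
  | r + 1 => ⟨CompletedTensorAlgebra (N (TimeExt (rankTensorAux r).carrier))⟩

/-- The rank `r` tensor algebra: `T⁰(V) = V`, and `Tʳ⁺¹(V)` is the completed tensor algebra over
`ℝ ⊕ Tʳ(V)`. -/
def RankTensor (r : ℕ) : Type u := (rankTensorAux N V r).carrier

instance (r : ℕ) : NormedAddCommGroup (RankTensor N V r) := (rankTensorAux N V r).normed

instance (r : ℕ) : NormedSpace ℝ (RankTensor N V r) := (rankTensorAux N V r).space

instance (r : ℕ) : CompleteSpace (RankTensor N V r) := (rankTensorAux N V r).complete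

theorem rankTensor_succ (r : ℕ) :
    RankTensor N V (r + 1) = CompletedTensorAlgebra (N (TimeExt (RankTensor N V r))) := rfl

/-- A choice of tensor normalization on the tensor algebra of each rank `≥ 1`. -/
abbrev RankNormalization : Type u :=
  (r : ℕ) → TensorNormalization (N (TimeExt (RankTensor N V r)))

variable {N V}

/-- The robust expected signature of rank `r`: the identity for `r = 0`, and
`μ ↦ ∫ Λ(S(t ↦ expSigʳ(x(t)))) μ(dx)` for `r + 1`. -/
def robustExpSig {T : ℕ} [MeasurableSpace V] (L : RankNormalization N V) :
    (r : ℕ) → RankProb T V r → RankTensor N V r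
  | 0 => fun v => (show V from v)
  | r + 1 => fun μ =>
    (∫ x, (L r).toFun (signature (N (TimeExt (RankTensor N V r)))
        fun t => robustExpSig L r (x t))
      ∂((show ProbabilityMeasure (Fin (T + 1) → RankProb T V r) from μ :
        Measure (Fin (T + 1) → RankProb T V r))) :
      CompletedTensorAlgebra (N (TimeExt (RankTensor N V r))))

/-- The map `Φ_r`: the rank `r + 1` robust expected signature of the law of the rank `r`
prediction process. -/
def adaptedSig {T : ℕ} [MeasurableSpace V] [StandardBorelSpace V] [Nonempty V]
    (L : RankNormalization N V) (r : ℕ) (X : AdaptedProcess.{u, v} T V) :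
    RankTensor N V (r + 1) :=
  robustExpSig L (r + 1) (X.predictionLaw r)

end HigherRank

end

/-!
A rank `r` adapted functional is almost surely a fixed function of the rank `r` prediction path,
with conditional expectations becoming integrals against conditional laws. At the last time the
conditional law is a Dirac measure, so a prediction path determines those of lower rank; hence the
representing functions are the same for all processes, and inductively they generate the whole
σ-algebra of the path space, so their expectations determine the law.

For signatures, the shuffle identity makes the linear functionals of the robust signature span an
algebra, and this algebra separates paths: the pure time component of degree one is the
normalization scale times `T + 1`, and once the scale is known, the words `ℓ τ ⋯ τ` (`τ` the time
coordinate) give all polynomial moments of the increments seen by `ℓ`. By Stone–Weierstrass the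
expected robust signature is injective on measures; induction on the rank iterates this.
-/

noncomputable section

/-! ### Conditional laws -/

section CondLaw

variable {Ω E : Type*} {m : MeasurableSpace Ω} [mΩ : MeasurableSpace Ω] [MeasurableSpace E]
  [StandardBorelSpace E] [Nonempty E] {P : Measure Ω} [IsProbabilityMeasure P] {Y : Ω → E}

theorem condExp_comp_ae_eq_integral_condLaw {F : Type*} [NormedAddCommGroup F] [NormedSpace ℝ F]
    [CompleteSpace F] (hm : m ≤ mΩ) (hY : Measurable Y) {f : E → F} (hf : StronglyMeasurable f)
    (hfY : Integrable (f ∘ Y) P) :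
    P[f ∘ Y | m] =ᵐ[P] fun ω => ∫ y, f y ∂(condLaw P m Y ω : Measure E) := by
  have hid : @Measurable Ω Ω mΩ m id := measurable_id'' hm
  have h := condExp_ae_eq_integral_condDistrib (mβ := m) hid hY.aemeasurable hf hfY
  rwa [MeasurableSpace.comap_id] at h

theorem condLaw_ae_eq_dirac (hm : m ≤ mΩ) (hY : Measurable[m] Y) :
    ∀ᵐ ω ∂P, (condLaw P m Y ω : Measure E) = Measure.dirac (Y ω) := by
  have hid : @Measurable Ω Ω mΩ m id := measurable_id'' hm
  have h := ae_of_ae_map (@Measurable.aemeasurable _ _ _ m _ _ hid)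
    (condDistrib_comp_self (μ := P) (mβ := m) id hY)
  filter_upwards [h] with ω hω
  rwa [Function.comp_id, Kernel.deterministic_apply] at hω

end CondLaw

section PointOfDirac

variable {α : Type*} [MeasurableSpace α] [StandardBorelSpace α] [Nonempty α]

theorem exists_measurable_leftInverse_dirac :
    ∃ D : ProbabilityMeasure α → α, Measurable D ∧
      ∀ (μ : ProbabilityMeasure α) (x : α), (μ : Measure α) = Measure.dirac x → D μ = x := by
  have := standardBorelSpace_probabilityMeasure α
  let d : α → ProbabilityMeasure α := fun x => ⟨Measure.dirac x, inferInstance⟩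
  have hd : Measurable d := Measure.measurable_dirac.subtype_mk
  have hinj : Function.Injective d := fun x y h => dirac_eq_dirac_iff.1 (congrArg Subtype.val h)
  obtain ⟨D, hD, hDd⟩ := (hd.measurableEmbedding hinj).exists_measurable_extend
    measurable_id fun _ => inferInstance
  refine ⟨D, hD, fun μ x h => ?_⟩
  obtain rfl : μ = d x := Subtype.ext h
  exact congrFun hDd x

/-- A measurable left inverse of `x ↦ δ_x`; its values at other measures are irrelevant. -/
def pointOfDirac : ProbabilityMeasure α → α := exists_measurable_leftInverse_dirac.choose

theorem measurable_pointOfDirac : Measurable (pointOfDirac (α := α)) :=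
  exists_measurable_leftInverse_dirac.choose_spec.1

theorem pointOfDirac_eq {μ : ProbabilityMeasure α} {x : α}
    (h : (μ : Measure α) = Measure.dirac x) : pointOfDirac μ = x :=
  exists_measurable_leftInverse_dirac.choose_spec.2 μ x h

end PointOfDirac

/-! ### Recovering prediction processes of lower rank -/

namespace RankProb

variable {T : ℕ} {V : Type u} [MeasurableSpace V] {r : ℕ}

/-- A probability measure of rank `r + 1`, viewed as a measure on paths of rank `r`. -/
def toMeasure (μ : RankProb T V (r + 1)) : Measure (Fin (T + 1) → RankProb T V r) :=
  (show ProbabilityMeasure (Fin (T + 1) → RankProb T V r) from μ).1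

instance (μ : RankProb T V (r + 1)) : IsProbabilityMeasure μ.toMeasure :=
  (show ProbabilityMeasure (Fin (T + 1) → RankProb T V r) from μ).2

theorem toMeasure_injective : Function.Injective (toMeasure : RankProb T V (r + 1) → _) :=
  fun _ _ h => Subtype.ext h

theorem measurable_toMeasure : Measurable (toMeasure : RankProb T V (r + 1) → _) :=
  measurable_subtype_coe (α := Measure (Fin (T + 1) → RankProb T V r))

theorem stronglyMeasurable_integral {E : Type*} [NormedAddCommGroup E] [NormedSpace ℝ E]
    {F : (Fin (T + 1) → RankProb T V r) → E} (hF : StronglyMeasurable F) :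
    StronglyMeasurable fun μ : RankProb T V (r + 1) => ∫ x, F x ∂μ.toMeasure :=
  hF.integral_kernel (κ := ⟨toMeasure, measurable_toMeasure⟩)

variable [StandardBorelSpace V] [Nonempty V]

/-- Recovers a rank `r` prediction path from the one of rank `r + 1`: at the last time the rank `r`
prediction process is known, so its conditional law is a Dirac measure. -/
def previousPath (x : Fin (T + 1) → RankProb T V (r + 1)) : Fin (T + 1) → RankProb T V r :=
  pointOfDirac (show ProbabilityMeasure (Fin (T + 1) → RankProb T V r) from x (Fin.last T))

theorem measurable_previousPath : Measurable (previousPath (T := T) (V := V) (r := r)) :=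
  measurable_pointOfDirac.comp (measurable_pi_apply (Fin.last T))

/-- Recovers a rank `k` prediction path from the one of rank `r ≥ k`. -/
def lowerPath {k : ℕ} (h : k ≤ r) :
    (Fin (T + 1) → RankProb T V r) → Fin (T + 1) → RankProb T V k :=
  Nat.leRec (motive := fun r _ => (Fin (T + 1) → RankProb T V r) → Fin (T + 1) → RankProb T V k)
    id (fun _ _ lower x => lower (previousPath x)) h

theorem lowerPath_self : lowerPath (T := T) (V := V) (le_refl r) = id := Nat.leRec_self _ _

theorem lowerPath_succ {k : ℕ} (h : k ≤ r) :
    lowerPath (T := T) (V := V) (Nat.le_succ_of_le h) = lowerPath h ∘ previousPath :=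
  Nat.leRec_succ _ _ h

theorem measurable_lowerPath {k : ℕ} (h : k ≤ r) : Measurable (lowerPath (T := T) (V := V) h) := by
  induction r, h using Nat.le_induction with
  | base =>
    rw [lowerPath_self]
    exact measurable_id
  | succ r h ih =>
    rw [lowerPath_succ h]
    exact ih.comp measurable_previousPath

end RankProb

namespace AdaptedProcess

variable {T : ℕ} {V : Type u} [MeasurableSpace V] [StandardBorelSpace V] [Nonempty V]

theorem measurable_prediction_last (X : AdaptedProcess.{u, v} T V) (r : ℕ) :
    Measurable[X.ℱ (Fin.last T)] (X.prediction r) := by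
  refine @measurable_pi_lambda _ _ _ (_) _ _ fun t => ?_
  have hle : X.ℱ t ≤ X.ℱ (Fin.last T) := X.ℱ.mono (Fin.le_last t)
  cases r with
  | zero => exact (X.adapted t).mono hle le_rfl
  | succ r => exact (measurable_condLaw X.P (X.ℱ t) (X.prediction r)).mono hle le_rfl

theorem previousPath_prediction_ae_eq (X : AdaptedProcess.{u, v} T V) (r : ℕ) :
    ∀ᵐ ω ∂X.P, RankProb.previousPath (X.prediction (r + 1) ω) = X.prediction r ω := by
  filter_upwards [condLaw_ae_eq_dirac (X.ℱ.le (Fin.last T)) (X.measurable_prediction_last r)]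
    with ω hω using pointOfDirac_eq hω

theorem lowerPath_prediction_ae_eq (X : AdaptedProcess.{u, v} T V) {k r : ℕ} (h : k ≤ r) :
    ∀ᵐ ω ∂X.P, RankProb.lowerPath h (X.prediction r ω) = X.prediction k ω := by
  induction r, h using Nat.le_induction with
  | base => simp [RankProb.lowerPath_self]
  | succ r h ih =>
    filter_upwards [ih, X.previousPath_prediction_ae_eq r] with ω hlower hprevious
    rw [RankProb.lowerPath_succ h, Function.comp_apply, hprevious, hlower]

theorem predictionLaw_eq_iff {X : AdaptedProcess.{u, v} T V} {Y : AdaptedProcess.{u, w} T V}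
    {r : ℕ} : X.predictionLaw r = Y.predictionLaw r ↔
      X.P.map (X.prediction r) = Y.P.map (Y.prediction r) :=
  RankProb.toMeasure_injective.eq_iff.symm

theorem map_last_jointPredictionLaw (X : AdaptedProcess.{u, v} T V) (r : ℕ) :
    (X.jointPredictionLaw r).map (fun x => x (Fin.last r)) = X.P.map (X.prediction r) :=
  Measure.map_map (measurable_pi_apply (Fin.last r))
    (measurable_pi_lambda _ fun i => X.measurable_prediction i)

theorem jointPredictionLaw_eq_map_lowerPath (X : AdaptedProcess.{u, v} T V) (r : ℕ) :
    X.jointPredictionLaw r = (X.P.map (X.prediction r)).map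
      fun x (i : Fin (r + 1)) => RankProb.lowerPath i.is_le x := by
  rw [Measure.map_map (measurable_pi_lambda _ fun i => RankProb.measurable_lowerPath i.is_le)
    (X.measurable_prediction r), jointPredictionLaw]
  refine Measure.map_congr ?_
  filter_upwards [ae_all_iff.2 fun i : Fin (r + 1) => X.lowerPath_prediction_ae_eq i.is_le]
    with ω hω
  exact funext fun i => (hω i).symm

theorem jointPredictionLaw_eq_iff {X : AdaptedProcess.{u, v} T V} {Y : AdaptedProcess.{u, w} T V}
    {r : ℕ} : X.jointPredictionLaw r = Y.jointPredictionLaw r ↔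
      X.predictionLaw r = Y.predictionLaw r := by
  rw [predictionLaw_eq_iff]
  constructor <;> intro h
  · rw [← map_last_jointPredictionLaw, h, map_last_jointPredictionLaw]
  · rw [jointPredictionLaw_eq_map_lowerPath, h, ← jointPredictionLaw_eq_map_lowerPath]

end AdaptedProcess

/-! ### Families of functions that determine measures -/

section Determining

variable {α : Type*} {𝒢 : Set (α → ℝ)}

/-- The σ-algebra generated by a family of real functions. -/
abbrev generatedMeasurableSpace (𝒢 : Set (α → ℝ)) : MeasurableSpace α :=
  ⨆ F ∈ 𝒢, MeasurableSpace.comap F inferInstance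

/-- The sets `{F > 0}` for `F` in a family of real functions. -/
def positivitySets (𝒢 : Set (α → ℝ)) : Set (Set α) := {s | ∃ F ∈ 𝒢, s = {x | 0 < F x}}

/-- A family of real functions that is stable under composition with bounded continuous functions
of finitely many variables. -/
def StableUnderBoundedContinuous (𝒢 : Set (α → ℝ)) : Prop :=
  ∀ (n : ℕ) (g : (Fin n → ℝ) →ᵇ ℝ) (F : Fin n → α → ℝ), (∀ i, F i ∈ 𝒢) →
    (fun x => g fun i => F i x) ∈ 𝒢

theorem measurable_generatedMeasurableSpace_of_mem {F : α → ℝ} (hF : F ∈ 𝒢) :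
    Measurable[generatedMeasurableSpace 𝒢] F :=
  measurable_iff_comap_le.2 (le_iSup₂ (f := fun F (_ : F ∈ 𝒢) => MeasurableSpace.comap F _) F hF)

/-- The bounded continuous function obtained from `h` by clamping its values to `[0, 1]`. -/
def clamp {β : Type*} [TopologicalSpace β] (h : C(β, ℝ)) : β →ᵇ ℝ :=
  BoundedContinuousFunction.ofNormedAddCommGroup (fun x => max 0 (min 1 (h x)))
    (by fun_prop) 1 fun x => by
      rw [Real.norm_eq_abs, abs_of_nonneg (le_max_left _ _)]
      exact max_le zero_le_one (min_le_left _ _)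

theorem clamp_apply {β : Type*} [TopologicalSpace β] (h : C(β, ℝ)) (x : β) :
    clamp h x = max 0 (min 1 (h x)) := rfl

theorem clamp_pos_iff {β : Type*} [TopologicalSpace β] (h : C(β, ℝ)) (x : β) :
    0 < clamp h x ↔ 0 < h x := by
  simp [clamp_apply]

theorem measurable_of_forall_boundedContinuousFunction {β : Type*} [MeasurableSpace α]
    [TopologicalSpace β] [TopologicalSpace.PseudoMetrizableSpace β] [MeasurableSpace β]
    [BorelSpace β] {f : α → β} (h : ∀ g : β →ᵇ ℝ, Measurable fun x => g (f x)) :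
    Measurable f := by
  let := TopologicalSpace.pseudoMetrizableSpacePseudoMetric β
  refine measurable_of_isClosed' fun s hs hne _ => .of_compl ?_
  have hpos := measurableSet_lt (measurable_const (a := (0 : ℝ)))
    (h (clamp ⟨fun y => Metric.infDist y s, Metric.continuous_infDist_pt s⟩))
  simp only [clamp_pos_iff, ContinuousMap.coe_mk, ← hs.notMem_iff_infDist_pos hne] at hpos
  exact hpos

theorem abs_clamp_le_one {β : Type*} [TopologicalSpace β] (h : C(β, ℝ)) (x : β) :
    |clamp h x| ≤ 1 := by
  rw [clamp_apply, abs_of_nonneg (le_max_left _ _)]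
  exact max_le zero_le_one (min_le_left _ _)

theorem tendsto_clamp_nat_mul (y : ℝ) :
    Tendsto (fun k : ℕ => clamp ((k : ℝ) • ContinuousMap.id ℝ) y) atTop
      (𝓝 ((Ioi (0 : ℝ)).indicator 1 y)) := by
  simp only [clamp_apply, ContinuousMap.smul_apply, ContinuousMap.id_apply, smul_eq_mul]
  by_cases hy : 0 < y
  · rw [indicator_of_mem (by exact hy)]
    refine tendsto_const_nhds.congr' ?_
    filter_upwards [(tendsto_natCast_atTop_atTop.atTop_mul_const hy).eventually_ge_atTop 1]
      with k hk
    simp [hk]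
  · rw [indicator_of_notMem (by exact hy)]
    refine tendsto_const_nhds.congr fun k => ?_
    rw [max_eq_left]
    exact (min_le_right _ _).trans (mul_nonpos_of_nonneg_of_nonpos k.cast_nonneg (not_lt.1 hy))

theorem tendsto_integral_clamp [MeasurableSpace α] {F : α → ℝ} (hF : Measurable F) (μ : Measure α)
    [IsFiniteMeasure μ] :
    Tendsto (fun k : ℕ => ∫ x, clamp ((k : ℝ) • ContinuousMap.id ℝ) (F x) ∂μ) atTop
      (𝓝 (μ.real {x | 0 < F x})) := by
  have hind : ∫ x, (Ioi (0 : ℝ)).indicator 1 (F x) ∂μ = μ.real {x | 0 < F x} :=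
    integral_indicator_one (measurableSet_lt measurable_const hF)
  rw [← hind]
  refine tendsto_integral_of_dominated_convergence (fun _ => 1) (fun k => ?_)
    (integrable_const 1) (fun k => Eventually.of_forall fun x => abs_clamp_le_one _ _)
    (Eventually.of_forall fun x => tendsto_clamp_nat_mul (F x))
  exact ((BoundedContinuousFunction.continuous _).measurable.comp hF).aestronglyMeasurable

namespace StableUnderBoundedContinuous

theorem clamp_comp_mem (h𝒢 : StableUnderBoundedContinuous 𝒢) {F : α → ℝ}
    (hF : F ∈ 𝒢) (g : C(ℝ, ℝ)) : (fun x => clamp g (F x)) ∈ 𝒢 :=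
  h𝒢 1 (clamp (g.comp ⟨fun y : Fin 1 → ℝ => y 0, by fun_prop⟩)) (fun _ => F) fun _ => hF

theorem isPiSystem_positivitySets (h𝒢 : StableUnderBoundedContinuous 𝒢) :
    IsPiSystem (positivitySets 𝒢) := by
  rintro _ ⟨F, hF, rfl⟩ _ ⟨G, hG, rfl⟩ -
  refine ⟨_, h𝒢 2 (clamp ⟨fun y : Fin 2 → ℝ => min (y 0) (y 1), by fun_prop⟩) ![F, G]
    (by simp [Fin.forall_fin_two, hF, hG]), ?_⟩
  ext x
  simp [clamp_pos_iff]

theorem generateFrom_positivitySets (h𝒢 : StableUnderBoundedContinuous 𝒢) :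
    MeasurableSpace.generateFrom (positivitySets 𝒢) = generatedMeasurableSpace 𝒢 := by
  refine le_antisymm (MeasurableSpace.generateFrom_le ?_) (iSup₂_le fun F hF => ?_)
  · rintro _ ⟨F, hF, rfl⟩
    exact measurable_generatedMeasurableSpace_of_mem hF measurableSet_Ioi
  · refine measurable_iff_comap_le.1 (measurable_of_Ioi fun a => ?_)
    refine MeasurableSpace.measurableSet_generateFrom
      ⟨_, h𝒢.clamp_comp_mem hF (ContinuousMap.id ℝ - .const ℝ a), ?_⟩
    ext x
    simp [clamp_pos_iff]

variable [mα : MeasurableSpace α]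

theorem measure_ext (h𝒢 : StableUnderBoundedContinuous 𝒢) (hgen : mα = generatedMeasurableSpace 𝒢)
    {μ ν : Measure α} [IsFiniteMeasure μ] [IsFiniteMeasure ν]
    (h : ∀ F ∈ 𝒢, ∫ x, F x ∂μ = ∫ x, F x ∂ν) : μ = ν := by
  have mass_eq : μ.real univ = ν.real univ := by
    simpa using h _ (h𝒢 0 1 (fun i => i.elim0) fun i => i.elim0)
  refine ext_of_generate_finite _ (hgen.trans h𝒢.generateFrom_positivitySets.symm)
    h𝒢.isPiSystem_positivitySets ?_ ((measureReal_eq_measureReal_iff).1 mass_eq)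
  rintro _ ⟨F, hF, rfl⟩
  have hFm : Measurable F := hgen ▸ measurable_generatedMeasurableSpace_of_mem hF
  refine (measureReal_eq_measureReal_iff).1 (tendsto_nhds_unique (tendsto_integral_clamp hFm μ) ?_)
  simpa only [h _ (h𝒢.clamp_comp_mem hF _)] using tendsto_integral_clamp hFm ν

theorem measurable_of_integral (h𝒢 : StableUnderBoundedContinuous 𝒢)
    (hgen : mα = generatedMeasurableSpace 𝒢) {β : Type*} [MeasurableSpace β]
    {κ : β → ProbabilityMeasure α}
    (h : ∀ F ∈ 𝒢, Measurable fun b => ∫ x, F x ∂(κ b : Measure α)) : Measurable κ := by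
  refine Measurable.subtype_mk (Measurable.measure_of_isPiSystem_of_isProbabilityMeasure
    (μ := fun b => (κ b : Measure α)) (hgen.trans h𝒢.generateFrom_positivitySets.symm)
    h𝒢.isPiSystem_positivitySets ?_)
  rintro _ ⟨F, hF, rfl⟩
  have hFm : Measurable F := hgen ▸ measurable_generatedMeasurableSpace_of_mem hF
  have hreal : Measurable fun b => (κ b : Measure α).real {x | 0 < F x} :=
    measurable_of_tendsto_metrizable (fun k => h _ (h𝒢.clamp_comp_mem hF _))
      (tendsto_pi_nhds.2 fun b => tendsto_integral_clamp hFm (κ b : Measure α))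
  simpa [Measure.real] using hreal.ennreal_ofReal

end StableUnderBoundedContinuous

end Determining

/-! ### Adapted functionals as functions of the prediction process -/

namespace AdaptedFunctional

variable {T : ℕ} {V : Type u} [TopologicalSpace V] [PolishSpace V] [MeasurableSpace V]
  [BorelSpace V]

theorem measurable_eval (X : AdaptedProcess.{u, v} T V) (f : AdaptedFunctional T V) :
    Measurable (f.eval X) := by
  induction f with
  | marginal n t g =>
    exact g.continuous.measurable.comp
      (measurable_pi_lambda _ fun i => (X.adapted (t i)).mono (X.ℱ.le (t i)) le_rfl)
  | comp n g f ih => exact g.continuous.measurable.comp (measurable_pi_lambda _ ih)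
  | condExp t f _ => exact (stronglyMeasurable_condExp.mono (X.ℱ.le t)).measurable

theorem integrable_eval (X : AdaptedProcess.{u, v} T V) (f : AdaptedFunctional T V) :
    Integrable (f.eval X) X.P := by
  have hm := (f.measurable_eval X).aestronglyMeasurable (μ := X.P)
  cases f with
  | marginal n t g => exact .of_bound hm ‖g‖ (.of_forall fun ω => g.norm_coe_le_norm _)
  | comp n g f => exact .of_bound hm ‖g‖ (.of_forall fun ω => g.norm_coe_le_norm _)
  | condExp t f => exact integrable_condExp

variable [Nonempty V]

/-- The function of the rank `r` prediction path that represents an adapted functional of rank at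
most `r`. Conditional expectations are turned into integrals against the conditional law; the value
`0` for a conditional expectation in the case `r = 0` is irrelevant. -/
def represent : AdaptedFunctional T V → (r : ℕ) → (Fin (T + 1) → RankProb T V r) → ℝ
  | marginal _ t g, r => fun x => g fun i => RankProb.lowerPath (Nat.zero_le r) x (t i)
  | comp _ g f, r => fun x => g fun i => (f i).represent r x
  | condExp _ _, 0 => 0
  | condExp t f, r + 1 => fun x => ∫ y, f.represent r y ∂(x t).toMeasure

theorem measurable_represent (f : AdaptedFunctional T V) (r : ℕ) :
    Measurable (f.represent r) := by
  induction f generalizing r with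
  | marginal n t g =>
    exact g.continuous.measurable.comp (measurable_pi_lambda _ fun i =>
      (measurable_pi_apply (t i)).comp (RankProb.measurable_lowerPath (Nat.zero_le r)))
  | comp n g f ih => exact g.continuous.measurable.comp (measurable_pi_lambda _ fun i => ih i r)
  | condExp t f ih =>
    cases r with
    | zero => exact measurable_const
    | succ r =>
      exact (RankProb.stronglyMeasurable_integral (ih r).stronglyMeasurable).measurable.comp
        (measurable_pi_apply t)

theorem eval_ae_eq_represent (X : AdaptedProcess.{u, v} T V) (f : AdaptedFunctional T V) {r : ℕ}
    (hr : f.rank ≤ r) : f.eval X =ᵐ[X.P] f.represent r ∘ X.prediction r := by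
  induction f generalizing r with
  | marginal n t g =>
    filter_upwards [X.lowerPath_prediction_ae_eq (Nat.zero_le r)] with ω hω
    simp only [represent, Function.comp_apply, hω]
    rfl
  | comp n g f ih =>
    have hcomp := fun i => ih i ((Finset.le_sup (Finset.mem_univ i)).trans hr)
    filter_upwards [ae_all_iff.2 hcomp] with ω hω
    simp only [eval, represent, Function.comp_apply, hω]
  | condExp t f ih =>
    obtain _ | r := r
    · exact absurd hr (Nat.not_succ_le_zero _)
    have hf := ih (Nat.le_of_succ_le_succ hr)
    exact (condExp_congr_ae hf).trans <| condExp_comp_ae_eq_integral_condLaw (X.ℱ.le t)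
      (X.measurable_prediction r) (f.measurable_represent r).stronglyMeasurable
      ((f.integrable_eval X).congr hf)

theorem integral_eval_eq_integral_represent (X : AdaptedProcess.{u, v} T V)
    (f : AdaptedFunctional T V) {r : ℕ} (hr : f.rank ≤ r) :
    ∫ ω, f.eval X ω ∂X.P = ∫ x, f.represent r x ∂X.P.map (X.prediction r) := by
  rw [integral_map (X.measurable_prediction r).aemeasurable
    (f.measurable_represent r).aestronglyMeasurable]
  exact integral_congr_ae (f.eval_ae_eq_represent X hr)

variable (T V) in
/-- The functions of the rank `r` prediction path that represent adapted functionals of rank at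
most `r`. -/
def representingFunctions (r : ℕ) : Set ((Fin (T + 1) → RankProb T V r) → ℝ) :=
  {F | ∃ f : AdaptedFunctional T V, f.rank ≤ r ∧ f.represent r = F}

theorem stableUnderBoundedContinuous_representingFunctions (r : ℕ) :
    StableUnderBoundedContinuous (representingFunctions T V r) := by
  intro n g F hF
  choose f hr hfF using hF
  exact ⟨.comp n g f, Finset.sup_le fun i _ => hr i, by simp only [represent, hfF]⟩

theorem measurable_eval_generatedMeasurableSpace_zero (t : Fin (T + 1)) :
    @Measurable (Fin (T + 1) → V) V (generatedMeasurableSpace (representingFunctions T V 0)) _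
      fun x => x t := by
  refine @measurable_of_forall_boundedContinuousFunction _ _ (_) _ _ _ _ _ fun g => ?_
  have hg : (fun x : Fin (T + 1) → V => g (x t)) ∈ representingFunctions T V 0 :=
    ⟨.marginal 1 (fun _ => t) (g.compContinuous ⟨fun y => y 0, by fun_prop⟩), le_rfl, rfl⟩
  exact measurable_generatedMeasurableSpace_of_mem hg

theorem measurable_eval_generatedMeasurableSpace_succ {r : ℕ}
    (hgen : (inferInstance : MeasurableSpace (Fin (T + 1) → RankProb T V r)) =
      generatedMeasurableSpace (representingFunctions T V r)) (t : Fin (T + 1)) :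
    Measurable[generatedMeasurableSpace (representingFunctions T V (r + 1))]
      fun x : Fin (T + 1) → RankProb T V (r + 1) => x t := by
  refine @StableUnderBoundedContinuous.measurable_of_integral _ _ _
    (stableUnderBoundedContinuous_representingFunctions r) hgen _ (_)
    (fun x : Fin (T + 1) → RankProb T V (r + 1) => x t) ?_
  rintro _ ⟨f, hr, rfl⟩
  exact measurable_generatedMeasurableSpace_of_mem
    ⟨.condExp t f, Nat.succ_le_succ hr, rfl⟩

theorem measurableSpace_eq_generatedMeasurableSpace_representingFunctions (r : ℕ) :
    (inferInstance : MeasurableSpace (Fin (T + 1) → RankProb T V r)) =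
      generatedMeasurableSpace (representingFunctions T V r) := by
  have hle (r : ℕ) : generatedMeasurableSpace (representingFunctions T V r) ≤
      (inferInstance : MeasurableSpace (Fin (T + 1) → RankProb T V r)) := by
    refine iSup₂_le ?_
    rintro _ ⟨f, -, rfl⟩
    exact measurable_iff_comap_le.1 (f.measurable_represent r)
  refine le_antisymm ?_ (hle r)
  induction r with
  | zero =>
    exact iSup_le fun t => (measurable_eval_generatedMeasurableSpace_zero (V := V) t).comap_le
  | succ r ih =>
    exact iSup_le fun t =>
      (measurable_eval_generatedMeasurableSpace_succ (le_antisymm ih (hle r)) t).comap_le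

theorem forall_integral_eval_eq_iff_predictionLaw_eq (X : AdaptedProcess.{u, v} T V)
    (Y : AdaptedProcess.{u, w} T V) (r : ℕ) :
    (∀ f : AdaptedFunctional T V, f.rank ≤ r →
      ∫ ω, f.eval X ω ∂X.P = ∫ ω, f.eval Y ω ∂Y.P) ↔ X.predictionLaw r = Y.predictionLaw r := by
  rw [AdaptedProcess.predictionLaw_eq_iff]
  constructor
  · intro h
    refine (stableUnderBoundedContinuous_representingFunctions r).measure_ext
      (measurableSpace_eq_generatedMeasurableSpace_representingFunctions r) ?_
    rintro _ ⟨f, hr, rfl⟩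
    simpa only [integral_eval_eq_integral_represent _ f hr] using h f hr
  · intro h f hr
    simp only [integral_eval_eq_integral_represent _ f hr, h]

end AdaptedFunctional

/-! ### Words: deconcatenation and shuffles -/

section Words

variable {D : Type*}

/-- The ways to write a word as a concatenation of two words. -/
def splits : List D → Multiset (List D × List D)
  | [] => {([], [])}
  | a :: w => ([], a :: w) ::ₘ (splits w).map fun p => (a :: p.1, p.2)

/-- The shuffles of two words, counted with multiplicity. -/
def shuffle : List D → List D → Multiset (List D)
  | [], v => {v}
  | a :: u, [] => {a :: u}
  | a :: u, b :: v => (shuffle u (b :: v)).map (a :: ·) + (shuffle (a :: u) v).map (b :: ·)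
termination_by u v => u.length + v.length

theorem shuffle_nil_left (v : List D) : shuffle [] v = {v} := by rw [shuffle]

theorem shuffle_nil_right (u : List D) : shuffle u [] = {u} := by cases u <;> rw [shuffle]

theorem shuffle_cons_cons (a b : D) (u v : List D) : shuffle (a :: u) (b :: v) =
    (shuffle u (b :: v)).map (a :: ·) + (shuffle (a :: u) v).map (b :: ·) := by rw [shuffle]

theorem perm_append_of_mem_shuffle {u v w : List D} (hw : w ∈ shuffle u v) : w.Perm (u ++ v) := by
  induction u, v using shuffle.induct generalizing w with
  | case1 v => simp_all [shuffle_nil_left]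
  | case2 a u => simp_all [shuffle_nil_right]
  | case3 a u b v ihu ihv =>
    simp only [shuffle_cons_cons, Multiset.mem_add, Multiset.mem_map] at hw
    obtain ⟨w, hw, rfl⟩ | ⟨w, hw, rfl⟩ := hw
    · exact (ihu hw).cons a
    · exact ((ihv hw).cons b).trans List.perm_middle.symm

theorem card_shuffle (u v : List D) :
    (shuffle u v).card = (u.length + v.length).choose u.length := by
  induction u, v using shuffle.induct with
  | case1 v => simp [shuffle_nil_left]
  | case2 a u => simp [shuffle_nil_right]
  | case3 a u b v ihu ihv =>
    simp only [shuffle_cons_cons, Multiset.card_add, Multiset.card_map, ihu, ihv, List.length_cons]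
    rw [← add_assoc (u.length + 1), Nat.choose_succ_succ, add_right_comm]
    rfl

theorem sum_map_splits {M : Type*} [AddCommMonoid M] (F : List D × List D → M) (w : List D) :
    ((splits w).map F).sum = ∑ i ∈ Finset.range (w.length + 1), F (w.take i, w.drop i) := by
  induction w generalizing F with
  | nil => simp [splits]
  | cons a w ih =>
    rw [splits, Multiset.map_cons, Multiset.map_map, Multiset.sum_cons, ih, List.length_cons,
      Finset.sum_range_succ' _ (w.length + 1), add_comm]
    simp

theorem bind_splits_shuffle (u v : List D) :
    (shuffle u v).bind splits = (splits u).bind fun p => (splits v).bind fun q =>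
      shuffle p.1 q.1 ×ˢ shuffle p.2 q.2 := by
  have bind_self (s : Multiset (List D × List D)) : s.bind (fun p => {p}) = s :=
    (Multiset.bind_singleton s id).trans s.map_id
  induction u, v using shuffle.induct with
  | case1 v => simp [shuffle_nil_left, splits, bind_self]
  | case2 a u => simp [shuffle_nil_right, splits, bind_self]
  | case3 a u b v ihu ihv =>
    simp only [splits, SProd.sprod, Multiset.product, shuffle_nil_left, shuffle_nil_right,
      shuffle_cons_cons, Multiset.cons_bind, Multiset.bind_cons, Multiset.bind_map,
      Multiset.map_map, Multiset.map_add, Multiset.bind_add, Multiset.add_bind,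
      Multiset.singleton_bind, Function.comp_def] at ihu ihv ⊢
    rw [← Multiset.map_bind, ihu, ← Multiset.map_bind, ihv]
    simp only [Multiset.map_bind, Multiset.map_map, Multiset.map_add, Function.comp_def]
    abel

section CommSemiring

variable {R : Type*} [CommSemiring R] {φ ψ : List D → R}

/-- Characters of the shuffle algebra: functionals on words which, extended linearly, are
multiplicative for the shuffle product. -/
structure IsShuffleCharacter (φ : List D → R) : Prop where
  nil : φ [] = 1
  mul : ∀ u v, φ u * φ v = ((shuffle u v).map φ).sum

/-- The convolution product of functionals on words, dual to deconcatenation. -/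
def wordConv (φ ψ : List D → R) (w : List D) : R := ((splits w).map fun p => φ p.1 * ψ p.2).sum

theorem IsShuffleCharacter.conv (hφ : IsShuffleCharacter φ) (hψ : IsShuffleCharacter ψ) :
    IsShuffleCharacter (wordConv φ ψ) where
  nil := by simp [wordConv, splits, hφ.nil, hψ.nil]
  mul u v := by
    have sum_product (s t : Multiset (List D)) :
        ((s ×ˢ t).map fun p => φ p.1 * ψ p.2).sum = (s.map φ).sum * (t.map ψ).sum := by
      simp only [SProd.sprod, Multiset.product, Multiset.map_bind, Multiset.sum_bind,
        Multiset.map_map, Function.comp_def, Multiset.sum_map_mul_left, Multiset.sum_map_mul_right]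
    calc wordConv φ ψ u * wordConv φ ψ v
        = ((splits u).map fun p => ((splits v).map fun q =>
            φ p.1 * φ q.1 * (ψ p.2 * ψ q.2)).sum).sum := by
          simp only [wordConv, mul_mul_mul_comm (φ (Prod.fst _)) (φ _) (ψ _),
            Multiset.sum_map_mul_left, Multiset.sum_map_mul_right]
      _ = (((shuffle u v).bind splits).map fun p => φ p.1 * ψ p.2).sum := by
          simp only [bind_splits_shuffle, Multiset.map_bind, Multiset.sum_bind, sum_product,
            hφ.mul, hψ.mul]
      _ = ((shuffle u v).map (wordConv φ ψ)).sum := by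
          rw [Multiset.map_bind, Multiset.sum_bind]
          rfl

theorem IsShuffleCharacter.dilate (hφ : IsShuffleCharacter φ) (c : R) :
    IsShuffleCharacter fun w => c ^ w.length * φ w where
  nil := by simp [hφ.nil]
  mul u v := by
    have length_eq : ∀ w ∈ shuffle u v, c ^ w.length * φ w = c ^ (u.length + v.length) * φ w :=
      fun w hw => by rw [(perm_append_of_mem_shuffle hw).length_eq, List.length_append]
    rw [Multiset.map_congr rfl length_eq, Multiset.sum_map_mul_left, ← hφ.mul, pow_add,
      mul_mul_mul_comm]

end CommSemiring

section Field

variable {K : Type*} [Field K]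

/-- The exponential of a functional on letters. -/
def wordExp (c : D → K) (w : List D) : K := (w.length.factorial : K)⁻¹ * (w.map c).prod

/-- The product of the exponentials of a list of functionals on letters; the empty product is
`wordExp 0`, the counit of the shuffle algebra. -/
def wordSig : List (D → K) → List D → K
  | [] => wordExp 0
  | c :: l => wordConv (wordExp c) (wordSig l)

/-- The sum `∑ₜ dₜ (f (kₜ + 1) - f kₜ)`, where `kₜ` is the number of entries after the `t`-th. -/
def incrementSum : List K → (ℕ → K) →ₗ[K] K
  | [] => 0
  | d :: l => d • ((LinearMap.proj (l.length + 1) : (ℕ → K) →ₗ[K] K) - LinearMap.proj l.length) +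
      incrementSum l

theorem incrementSum_cons_apply (d : K) (l : List K) (f : ℕ → K) :
    incrementSum (d :: l) f = d * (f (l.length + 1) - f l.length) + incrementSum l f := rfl

theorem incrementSum_const (l : List K) (a : K) : incrementSum l (fun _ => a) = 0 := by
  induction l with
  | nil => rfl
  | cons d l ih => rw [incrementSum_cons_apply, sub_self, mul_zero, zero_add, ih]

theorem incrementSum_congr {l : List K} {f g : ℕ → K} (h : ∀ k ≤ l.length, f k = g k) :
    incrementSum l f = incrementSum l g := by
  induction l with
  | nil => rfl
  | cons d l ih =>
    rw [incrementSum_cons_apply, incrementSum_cons_apply, h (l.length + 1) le_rfl,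
      h _ (Nat.le_succ _), ih fun k hk => h k (hk.trans (Nat.le_succ _))]

theorem eq_of_incrementSum_eq {l l' : List K} (hlen : l.length = l'.length)
    (h : incrementSum l = incrementSum l') : l = l' := by
  induction l generalizing l' with
  | nil => exact (List.length_eq_zero_iff.1 hlen.symm).symm
  | cons d l ih =>
    obtain _ | ⟨d', l'⟩ := l'
    · simp at hlen
    have hlen' : l.length = l'.length := by simpa using hlen
    have apply_single (e : K) (k : List K) : incrementSum (e :: k)
        (Pi.single (k.length + 1) 1) = e := by
      rw [incrementSum_cons_apply, incrementSum_congr (l := k) (g := 0) fun i hi =>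
        Pi.single_eq_of_ne (Nat.lt_succ_of_le hi).ne _]
      simp
    have hd : d = d' := by
      rw [← apply_single d l, h, hlen', apply_single]
    subst hd
    rw [ih hlen' (LinearMap.ext fun f => ?_)]
    simpa only [incrementSum_cons_apply, hlen', add_right_inj] using LinearMap.congr_fun h f

variable [CharZero K]

theorem isShuffleCharacter_wordExp (c : D → K) : IsShuffleCharacter (wordExp c) where
  nil := by simp [wordExp]
  mul u v := by
    have wordExp_eq : ∀ w ∈ shuffle u v, wordExp c w =
        ((u.length + v.length).factorial : K)⁻¹ * ((u.map c).prod * (v.map c).prod) :=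
      fun w hw => by
        have hw := perm_append_of_mem_shuffle hw
        rw [wordExp, hw.length_eq, (hw.map c).prod_eq, List.length_append, List.map_append,
          List.prod_append]
    rw [Multiset.map_congr rfl wordExp_eq, Multiset.map_const', Multiset.sum_replicate,
      card_shuffle, nsmul_eq_mul, Nat.cast_add_choose, wordExp, wordExp]
    have := Nat.cast_ne_zero (R := K).2 (u.length + v.length).factorial_ne_zero
    field_simp

theorem isShuffleCharacter_wordSig (l : List (D → K)) : IsShuffleCharacter (wordSig l) := by
  induction l with
  | nil => exact isShuffleCharacter_wordExp 0
  | cons c l ih => exact (isShuffleCharacter_wordExp c).conv ih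

section TimeLetter

variable {τ : D} {l l' : List (D → K)}

theorem sum_map_splits_replicate {M : Type*} [AddCommMonoid M] (F : List D × List D → M) (a : D)
    (j : ℕ) : ((splits (List.replicate j a)).map F).sum =
      ∑ i ∈ Finset.range (j + 1), F (List.replicate i a, List.replicate (j - i) a) := by
  rw [sum_map_splits, List.length_replicate]
  refine Finset.sum_congr rfl fun i hi => ?_
  rw [List.take_replicate, List.drop_replicate,
    min_eq_left (Nat.lt_succ_iff.1 (Finset.mem_range.1 hi))]

theorem wordSig_replicate (hl : ∀ c ∈ l, c τ = 1) (j : ℕ) :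
    (j.factorial : K) * wordSig l (List.replicate j τ) = (l.length : K) ^ j := by
  induction l generalizing j with
  | nil => cases j <;> simp [wordSig, wordExp]
  | cons c l ih =>
    rw [wordSig, wordConv, sum_map_splits_replicate, List.length_cons, Nat.cast_add, Nat.cast_one,
      add_comm (l.length : K), add_pow, Finset.mul_sum]
    refine Finset.sum_congr rfl fun i hi => ?_
    have hi' : i ≤ j := Nat.lt_succ_iff.1 (Finset.mem_range.1 hi)
    rw [← ih (fun c hc => hl c (List.mem_cons_of_mem _ hc)), wordExp, List.length_replicate,
      List.map_replicate, hl c List.mem_cons_self, List.prod_replicate, one_pow,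
      ← Nat.choose_mul_factorial_mul_factorial hi']
    have := Nat.cast_ne_zero (R := K).2 i.factorial_ne_zero
    push_cast
    field_simp

theorem wordSig_cons_replicate (hl : ∀ c ∈ l, c τ = 1) (ℓ : D) (j : ℕ) :
    ((j + 1).factorial : K) * wordSig l (ℓ :: List.replicate j τ) =
      incrementSum (l.map fun c => c ℓ) fun k => (k : K) ^ (j + 1) := by
  induction l with
  | nil => simp [wordSig, wordExp, incrementSum]
  | cons c l ih =>
    have hl' : ∀ c ∈ l, c τ = 1 := fun c hc => hl c (List.mem_cons_of_mem _ hc)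
    have term_eq : ∀ i ∈ Finset.range (j + 1), ((j + 1).factorial : K) *
        (wordExp c (ℓ :: List.replicate i τ) * wordSig l (List.replicate (j - i) τ)) =
          c ℓ * ((l.length : K) ^ (j - i) * ((j + 1).choose (i + 1) : K)) := fun i hi => by
      have hi' : i + 1 ≤ j + 1 := Nat.succ_le_of_lt (Finset.mem_range.1 hi)
      rw [← wordSig_replicate hl', wordExp, List.length_cons, List.length_replicate,
        List.map_cons, List.map_replicate, hl c List.mem_cons_self, List.prod_cons,
        List.prod_replicate, one_pow, ← Nat.choose_mul_factorial_mul_factorial hi',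
        Nat.succ_sub_succ]
      have := Nat.cast_ne_zero (R := K).2 (i + 1).factorial_ne_zero
      push_cast
      field_simp
    have binomial : ((l.length : K) + 1) ^ (j + 1) - (l.length : K) ^ (j + 1) =
        ∑ i ∈ Finset.range (j + 1), (l.length : K) ^ (j - i) * ((j + 1).choose (i + 1) : K) := by
      rw [add_comm (l.length : K), add_pow, Finset.sum_range_succ' _ (j + 1)]
      simp
    rw [wordSig, wordConv, splits, Multiset.map_cons, Multiset.sum_cons, Multiset.map_map,
      Function.comp_def, sum_map_splits_replicate, mul_add, Finset.mul_sum,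
      Finset.sum_congr rfl term_eq, ← Finset.mul_sum, ← binomial, List.map_cons,
      incrementSum_cons_apply, ← ih hl', add_comm]
    simp [wordExp]

theorem incrementSum_eq_of_forall_pow {l l' : List K} (hlen : l.length = l'.length)
    (h : ∀ j : ℕ, incrementSum l (fun k => (k : K) ^ (j + 1)) =
      incrementSum l' fun k => (k : K) ^ (j + 1)) : incrementSum l = incrementSum l' := by
  have eq_on_polynomials (p : Polynomial K) :
      incrementSum l (fun k => p.eval (k : K)) = incrementSum l' fun k => p.eval (k : K) := by
    have eval_eq : (fun k : ℕ => p.eval (k : K)) =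
        ∑ i ∈ Finset.range (p.natDegree + 1), p.coeff i • fun k : ℕ => (k : K) ^ i := by
      ext k
      simp [Polynomial.eval_eq_sum_range]
    simp only [eval_eq, map_sum, map_smul]
    refine Finset.sum_congr rfl fun i _ => ?_
    cases i with
    | zero => simp only [pow_zero, incrementSum_const]
    | succ j => rw [h j]
  ext1 f
  let p := Lagrange.interpolate (Finset.range (l.length + 1)) (fun k : ℕ => (k : K)) f
  have interpolates : ∀ k ≤ l.length, f k = p.eval (k : K) := fun k hk =>
    (Lagrange.eval_interpolate_at_node f Nat.cast_injective.injOn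
      (Finset.mem_range.2 (Nat.lt_succ_of_le hk))).symm
  rw [incrementSum_congr interpolates, eq_on_polynomials,
    incrementSum_congr fun k hk => (interpolates k (hlen ▸ hk)).symm]

theorem map_apply_eq_of_wordSig_eq (hlen : l.length = l'.length)
    (hl : ∀ c ∈ l, c τ = 1) (hl' : ∀ c ∈ l', c τ = 1) (h : wordSig l = wordSig l') (ℓ : D) :
    (l.map fun c => c ℓ) = l'.map fun c => c ℓ := by
  have hlen : (l.map fun c => c ℓ).length = (l'.map fun c => c ℓ).length := by simpa using hlen
  refine eq_of_incrementSum_eq hlen (incrementSum_eq_of_forall_pow hlen fun j => ?_)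
  rw [← wordSig_cons_replicate hl, ← wordSig_cons_replicate hl', h]

end TimeLetter

end Field

end Words

/-! ### Words of continuous functionals acting on tensor sequences -/

section Pairing

variable {F : Type u} [NormedAddCommGroup F] [NormedSpace ℝ F]

/-- The functional `ℓ₁ ⊗ ⋯ ⊗ ℓₘ` on the `m`-th tensor power. -/
def tensorFunctional {m : ℕ} (ℓ : Fin m → StrongDual ℝ F) : (⨂[ℝ]^m F) →ₗ[ℝ] ℝ :=
  PiTensorProduct.lift ((MultilinearMap.mkPiAlgebra ℝ (Fin m) ℝ).compLinearMap
    fun i => (ℓ i).toLinearMap)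

theorem tensorFunctional_tprod {m : ℕ} (ℓ : Fin m → StrongDual ℝ F) (v : Fin m → F) :
    tensorFunctional ℓ (PiTensorProduct.tprod ℝ v) = ∏ i, ℓ i (v i) := by
  simp [tensorFunctional]

theorem tensorFunctional_mul {i j : ℕ} (ℓ : Fin (i + j) → StrongDual ℝ F) (a : ⨂[ℝ]^i F)
    (b : ⨂[ℝ]^j F) :
    tensorFunctional ℓ (GradedMonoid.GMul.mul (A := fun i => ⨂[ℝ]^i F) a b) =
      tensorFunctional (fun k => ℓ (Fin.castAdd j k)) a *
        tensorFunctional (fun k => ℓ (Fin.natAdd i k)) b := by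
  rw [TensorPower.gMul_eq_coe_linearMap]
  induction a using PiTensorProduct.induction_on with
  | add a a' ha ha' => simp only [map_add, LinearMap.add_apply, ha, ha', add_mul]
  | smul_tprod c v =>
    induction b using PiTensorProduct.induction_on with
    | add b b' hb hb' => simp only [map_add, hb, hb', mul_add]
    | smul_tprod d v' =>
      simp only [map_smul, LinearMap.smul_apply]
      rw [← TensorPower.gMul_eq_coe_linearMap, TensorPower.tprod_mul_tprod,
        tensorFunctional_tprod, tensorFunctional_tprod, tensorFunctional_tprod,
        Fin.prod_univ_add]
      simp only [Fin.append_left, Fin.append_right, smul_eq_mul]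
      ring

/-- The functional on the `m`-th tensor power given by the first `m` letters of a word. -/
def wordFunctional (w : List (StrongDual ℝ F)) (m : ℕ) : (⨂[ℝ]^m F) →ₗ[ℝ] ℝ :=
  tensorFunctional fun k : Fin m => w.getD k 0

/-- The pairing of words with tensor sequences. -/
def wordPairing (s : (m : ℕ) → ⨂[ℝ]^m F) (w : List (StrongDual ℝ F)) : ℝ :=
  wordFunctional w w.length (s w.length)

theorem wordFunctional_mul (w : List (StrongDual ℝ F)) {i j m : ℕ} (h : i + j = m) (a : ⨂[ℝ]^i F)
    (b : ⨂[ℝ]^j F) :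
    wordFunctional w m (TensorPower.cast ℝ F h
      (GradedMonoid.GMul.mul (A := fun i => ⨂[ℝ]^i F) a b)) =
      wordFunctional w i a * wordFunctional (w.drop i) j b := by
  subst h
  rw [TensorPower.cast_refl, LinearEquiv.refl_apply, wordFunctional, tensorFunctional_mul]
  simp [wordFunctional, List.getD_eq_getElem?_getD, List.getElem?_drop]

theorem wordFunctional_take (w : List (StrongDual ℝ F)) (i : ℕ) :
    wordFunctional (w.take i) i = wordFunctional w i := by
  simp [wordFunctional, List.getD_eq_getElem?_getD]

theorem wordPairing_conv (s t : (m : ℕ) → ⨂[ℝ]^m F) :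
    wordPairing (tensorConv s t) = wordConv (wordPairing s) (wordPairing t) := by
  funext w
  rw [wordPairing, tensorConv, map_sum]
  simp only [wordFunctional_mul]
  rw [Finset.sum_attach _ fun p : ℕ × ℕ =>
      wordFunctional w p.1 (s p.1) * wordFunctional (w.drop p.1) p.2 (t p.2),
    Finset.Nat.sum_antidiagonal_eq_sum_range_succ fun i j =>
      wordFunctional w i (s i) * wordFunctional (w.drop i) j (t j),
    wordConv, sum_map_splits]
  refine Finset.sum_congr rfl fun i hi => ?_
  have hi' : i ≤ w.length := Nat.lt_succ_iff.1 (Finset.mem_range.1 hi)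
  rw [wordPairing, wordPairing, List.length_take, List.length_drop, min_eq_left hi',
    wordFunctional_take]

theorem wordPairing_one : wordPairing (tensorOne : (m : ℕ) → ⨂[ℝ]^m F) = wordExp 0 := by
  funext w
  cases w with
  | nil =>
    rw [wordPairing, wordFunctional]
    exact (tensorFunctional_tprod _ _).trans (by simp [wordExp])
  | cons a w => simp [wordPairing, tensorOne, wordExp]

theorem wordPairing_exp (v : F) : wordPairing (tensorExp v) = wordExp fun ℓ => ℓ v := by
  funext w
  rw [wordPairing, tensorExp, map_smul, wordFunctional, tensorFunctional_tprod, wordExp,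
    smul_eq_mul]
  congr 1
  rw [← List.prod_ofFn]
  congr 1
  refine List.ext_getElem (by simp) fun i h1 h2 => ?_
  simp

theorem wordPairing_foldr_tensorExp (l : List F) :
    wordPairing ((l.map tensorExp).foldr tensorConv tensorOne) =
      wordSig (l.map fun v (ℓ : StrongDual ℝ F) => ℓ v) := by
  induction l with
  | nil => exact wordPairing_one
  | cons v l ih =>
    rw [List.map_cons, List.foldr_cons, wordPairing_conv, ih, wordPairing_exp]
    rfl

theorem timeIncrement_injective {T : ℕ} {E : Type*} [NormedAddCommGroup E] :
    Function.Injective (timeIncrement : (Fin (T + 1) → E) → Fin (T + 1) → TimeExt E) := by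
  intro x y h
  have snd_eq (t : Fin (T + 1)) : (timeIncrement x t).snd = (timeIncrement y t).snd := by rw [h]
  funext t
  induction t using Fin.induction with
  | zero => exact snd_eq 0
  | succ s ih =>
    have sub_eq : x s.succ - x s.castSucc = y s.succ - y s.castSucc := snd_eq s.succ
    rw [ih] at sub_eq
    exact sub_left_injective sub_eq

section Path

variable {T : ℕ} {E : Type u} [NormedAddCommGroup E] [NormedSpace ℝ E] {x y : Fin (T + 1) → E}

/-- The increments of a time-extended path, as functionals on the dual space. -/
def incrementEvaluations (x : Fin (T + 1) → E) : List (StrongDual ℝ (TimeExt E) → ℝ) :=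
  List.ofFn fun t ℓ => ℓ (timeIncrement x t)

theorem length_incrementEvaluations : (incrementEvaluations x).length = T + 1 := List.length_ofFn

theorem apply_time_of_mem_incrementEvaluations :
    ∀ c ∈ incrementEvaluations x, c (WithLp.fstL 1 ℝ ℝ E) = 1 := by
  rw [incrementEvaluations, List.forall_mem_ofFn_iff]
  exact fun _ => rfl

theorem wordPairing_signatureSeq (x : Fin (T + 1) → E) :
    wordPairing (signatureSeq x) = wordSig (incrementEvaluations x) := by
  have h := wordPairing_foldr_tensorExp (List.ofFn (timeIncrement x))
  rwa [List.map_ofFn, List.map_ofFn] at h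

theorem wordPairing_signatureSeq_time (x : Fin (T + 1) → E) :
    wordPairing (signatureSeq x) [WithLp.fstL 1 ℝ ℝ E] = T + 1 := by
  have h := wordSig_replicate (apply_time_of_mem_incrementEvaluations (x := x)) 1
  simpa [wordPairing_signatureSeq, length_incrementEvaluations] using h

theorem eq_of_wordPairing_signatureSeq_eq
    (h : wordPairing (signatureSeq x) = wordPairing (signatureSeq y)) : x = y := by
  rw [wordPairing_signatureSeq, wordPairing_signatureSeq] at h
  refine timeIncrement_injective (funext fun t => ?_)
  refine (SeparatingDual.eq_iff_forall_dual_eq (R := ℝ)).2 fun ℓ => ?_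
  have map_eq := map_apply_eq_of_wordSig_eq
    (length_incrementEvaluations.trans length_incrementEvaluations.symm)
    apply_time_of_mem_incrementEvaluations apply_time_of_mem_incrementEvaluations h ℓ
  rw [incrementEvaluations, incrementEvaluations, List.map_ofFn, List.map_ofFn] at map_eq
  exact congrFun (List.ofFn_injective map_eq) t

end Path

end Pairing

/-! ### Continuity of the signature -/

section Continuity

variable {F : Type u} [NormedAddCommGroup F] [NormedSpace ℝ F] (N : AdmissibleNorm F)

/-- `wordFunctional` as a continuous functional on the normed tensor power. -/
def wordFunctionalCLM (w : List (StrongDual ℝ F)) (m : ℕ) :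
    StrongDual ℝ (NormedTensorPower N m) :=
  LinearMap.mkContinuousOfExistsBound (show NormedTensorPower N m →ₗ[ℝ] ℝ from wordFunctional w m)
    (N.continuous_functional m fun k => w.getD k 0)

/-- The extension of `wordFunctional` to the completed tensor power. -/
def completedWordFunctional (w : List (StrongDual ℝ F)) (m : ℕ) :
    StrongDual ℝ (CompletedTensorPower N m) :=
  (wordFunctionalCLM N w m).extend
    (UniformSpace.Completion.toComplL (𝕜 := ℝ) (E := NormedTensorPower N m))

theorem completedWordFunctional_coe (w : List (StrongDual ℝ F)) (m : ℕ) (t : ⨂[ℝ]^m F) :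
    completedWordFunctional N w m (toCompletedTensorPower N m t) = wordFunctional w m t :=
  ContinuousLinearMap.extend_eq (wordFunctionalCLM N w m)
    (e := UniformSpace.Completion.toComplL (𝕜 := ℝ) (E := NormedTensorPower N m))
    UniformSpace.Completion.denseRange_coe
    (UniformSpace.Completion.isUniformInducing_coe (NormedTensorPower N m)) t

/-- The continuous functional on the completed tensor algebra given by a word. -/
def wordDual (w : List (StrongDual ℝ F)) : StrongDual ℝ (CompletedTensorAlgebra N) :=
  (completedWordFunctional N w w.length).comp
    (lp.evalCLM ℝ (fun m => CompletedTensorPower N m) 1 w.length)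

theorem wordDual_apply (w : List (StrongDual ℝ F)) (s : CompletedTensorAlgebra N) :
    wordDual N w s = completedWordFunctional N w w.length (s w.length) := rfl

/-- Multiplication of tensors as a continuous bilinear map. -/
def tensorMulCLM (i j : ℕ) :
    NormedTensorPower N i →L[ℝ] NormedTensorPower N j →L[ℝ] NormedTensorPower N (i + j) :=
  LinearMap.mkContinuous₂ (show NormedTensorPower N i →ₗ[ℝ] NormedTensorPower N j →ₗ[ℝ]
      NormedTensorPower N (i + j) from
      (TensorProduct.mk ℝ (⨂[ℝ]^i F) (⨂[ℝ]^j F)).compr₂ TensorPower.mulEquiv.toLinearMap) 1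
    fun a b => by
      rw [one_mul]
      exact N.norm_mul_le i j a b

/-- Continuity of every component of a family of tensor sequences, for the norms `N`. -/
def ComponentwiseContinuous {Z : Type*} [TopologicalSpace Z] (s : Z → (m : ℕ) → ⨂[ℝ]^m F) : Prop :=
  ∀ m, Continuous fun z => (show NormedTensorPower N m from s z m)

variable {N} {Z : Type*} [TopologicalSpace Z]

theorem continuous_tensorMul {i j : ℕ} {a : Z → ⨂[ℝ]^i F} {b : Z → ⨂[ℝ]^j F}
    (ha : Continuous fun z => (show NormedTensorPower N i from a z))
    (hb : Continuous fun z => (show NormedTensorPower N j from b z)) :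
    Continuous fun z => (show NormedTensorPower N (i + j) from
      GradedMonoid.GMul.mul (A := fun i => ⨂[ℝ]^i F) (a z) (b z)) :=
  ((tensorMulCLM N i j).continuous.comp ha).clm_apply hb

theorem continuous_tensorCast {i j : ℕ} (h : i = j) {a : Z → ⨂[ℝ]^i F}
    (ha : Continuous fun z => (show NormedTensorPower N i from a z)) :
    Continuous fun z => (show NormedTensorPower N j from TensorPower.cast ℝ F h (a z)) := by
  subst h
  simpa using ha

theorem ComponentwiseContinuous.conv {s t : Z → (m : ℕ) → ⨂[ℝ]^m F}
    (hs : ComponentwiseContinuous N s) (ht : ComponentwiseContinuous N t) :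
    ComponentwiseContinuous N fun z => tensorConv (s z) (t z) := fun m =>
  continuous_finsetSum (M := NormedTensorPower N m) _ fun p _ =>
    continuous_tensorCast _ (continuous_tensorMul (hs p.1.1) (ht p.1.2))

theorem continuous_tensorSingle : Continuous fun v : F => (show NormedTensorPower N 1 from
    PiTensorProduct.tprod ℝ fun _ : Fin 1 => v) := by
  let single : F →ₗ[ℝ] NormedTensorPower N 1 :=
    (PiTensorProduct.subsingletonEquiv (R := ℝ) (s := fun _ : Fin 1 => F) 0).symm.toLinearMap
  have single_apply (v : F) : single v = PiTensorProduct.tprod ℝ fun _ : Fin 1 => v :=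
    PiTensorProduct.subsingletonEquiv_symm_apply' 0 v
  have continuous_single : Continuous single :=
    AddMonoidHomClass.continuous_of_bound single 1 fun v => by
      rw [single_apply, one_mul]
      exact (N.norm_single v).le
  exact continuous_single.congr single_apply

theorem tprod_const_succ (v : F) (m : ℕ) :
    PiTensorProduct.tprod ℝ (fun _ : Fin (m + 1) => v) =
      GradedMonoid.GMul.mul (A := fun i => ⨂[ℝ]^i F)
        (PiTensorProduct.tprod ℝ fun _ : Fin m => v)
        (PiTensorProduct.tprod ℝ fun _ : Fin 1 => v) := by
  rw [TensorPower.tprod_mul_tprod]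
  congr 1
  funext i
  refine Fin.addCases (fun i => ?_) (fun i => ?_) i <;> simp

theorem continuous_tensorPow (m : ℕ) : Continuous fun v : F => (show NormedTensorPower N m from
    PiTensorProduct.tprod ℝ fun _ : Fin m => v) := by
  induction m with
  | zero =>
    exact continuous_of_const fun v w =>
      congrArg (PiTensorProduct.tprod ℝ) (Subsingleton.elim (α := Fin 0 → F) _ _)
  | succ m ih =>
    exact (continuous_tensorMul ih continuous_tensorSingle).congr fun v =>
      (tprod_const_succ v m).symm

theorem componentwiseContinuous_exp {v : Z → F} (hv : Continuous v) :
    ComponentwiseContinuous N fun z => tensorExp (v z) := fun m =>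
  ((continuous_tensorPow (N := N) m).comp hv).const_smul (m.factorial : ℝ)⁻¹

theorem componentwiseContinuous_foldr_tensorExp {n : ℕ} {v : Z → Fin n → F} (hv : Continuous v) :
    ComponentwiseContinuous N fun z =>
      (List.ofFn fun t => tensorExp (v z t)).foldr tensorConv tensorOne := by
  induction n with
  | zero => exact fun m => by simpa using continuous_const
  | succ n ih =>
    have continuous_tail : Continuous fun z (t : Fin n) => v z t.succ :=
      continuous_pi fun t => (continuous_apply t.succ).comp hv
    simp only [List.ofFn_succ, List.foldr_cons]
    exact (componentwiseContinuous_exp ((continuous_apply 0).comp hv)).conv (ih continuous_tail)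

theorem sum_antidiagonal_pow_div_factorial (a b : ℝ) (m : ℕ) :
    ∑ p ∈ Finset.HasAntidiagonal.antidiagonal m,
      a ^ p.1 / p.1.factorial * (b ^ p.2 / p.2.factorial) = (a + b) ^ m / m.factorial := by
  rw [(Commute.all a b).add_pow', Finset.sum_div]
  refine Finset.sum_congr rfl fun p hp => ?_
  obtain rfl := Finset.HasAntidiagonal.mem_antidiagonal.1 hp
  rw [nsmul_eq_mul, Nat.cast_add_choose]
  field_simp

theorem AdmissibleNorm.norm_conv_le (N : AdmissibleNorm F) (s t : (m : ℕ) → ⨂[ℝ]^m F) (m : ℕ) :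
    N.norm m (tensorConv s t m) ≤ ∑ p ∈ Finset.HasAntidiagonal.antidiagonal m,
      N.norm p.1 (s p.1) * N.norm p.2 (t p.2) := by
  rw [tensorConv]
  conv_rhs => rw [← Finset.sum_attach]
  refine (Finset.le_sum_of_subadditive (N.norm m) (map_zero (N.norm m)).le
    (map_add_le_add (N.norm m)) _ _).trans (Finset.sum_le_sum fun p _ => ?_)
  rw [N.norm_cast]
  exact N.norm_mul_le _ _ _ _

theorem AdmissibleNorm.norm_exp_le (N : AdmissibleNorm F) (v : F) (m : ℕ) :
    N.norm m (tensorExp v m) ≤ ‖v‖ ^ m / m.factorial := by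
  rw [tensorExp, map_smul_eq_mul, Real.norm_eq_abs, abs_of_nonneg (by positivity), div_eq_inv_mul]
  exact mul_le_mul_of_nonneg_left (N.norm_pow_le v m) (by positivity)

theorem AdmissibleNorm.norm_foldr_tensorExp_le (N : AdmissibleNorm F) (l : List F) (m : ℕ) :
    N.norm m ((l.map tensorExp).foldr tensorConv tensorOne m) ≤
      (l.map fun v => ‖v‖).sum ^ m / m.factorial := by
  induction l generalizing m with
  | nil =>
    cases m with
    | zero => simpa [tensorOne] using N.norm_unit.le
    | succ m => simp [tensorOne]
  | cons v l ih =>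
    simp only [List.map_cons, List.foldr_cons, List.sum_cons]
    rw [← sum_antidiagonal_pow_div_factorial]
    refine (N.norm_conv_le _ _ m).trans (Finset.sum_le_sum fun p _ => ?_)
    exact mul_le_mul (N.norm_exp_le v _) (ih _) (apply_nonneg _ _) (by positivity)

theorem lp_one_norm_eq_tsum {ι : Type*} {G : ι → Type*} [∀ i, NormedAddCommGroup (G i)]
    (f : lp G 1) : ‖f‖ = ∑' i, ‖f i‖ := by
  simp [lp.norm_eq_tsum_rpow (p := 1) (by simp) f]

theorem continuousAt_lp_one {ι : Type*} {G : ι → Type*} [∀ i, NormedAddCommGroup (G i)]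
    {f : Z → lp G 1} {z₀ : Z} (hf : ∀ i, ContinuousAt (fun z => f z i) z₀) {b : ι → ℝ}
    (hb : Summable b) (hfb : ∀ᶠ z in 𝓝 z₀, ∀ i, ‖f z i‖ ≤ b i) : ContinuousAt f z₀ := by
  rw [ContinuousAt, tendsto_iff_norm_sub_tendsto_zero]
  simp_rw [lp_one_norm_eq_tsum]
  have h0 : (0 : ℝ) = ∑' _ : ι, (0 : ℝ) := by simp
  rw [h0]
  refine tendsto_tsum_of_dominated_convergence (bound := fun i => b i + b i) (hb.add hb)
    (fun i => ?_) ?_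
  · have := (hf i).tendsto
    rw [tendsto_iff_norm_sub_tendsto_zero] at this
    exact this
  · filter_upwards [hfb] with z hz i
    rw [norm_norm]
    exact (norm_sub_le _ _).trans (add_le_add (hz i) (hfb.self_of_nhds i))

theorem continuous_timeIncrement {T : ℕ} {E : Type*} [NormedAddCommGroup E] :
    Continuous fun x : Fin (T + 1) → E => timeIncrement x := by
  refine continuous_pi fun t => (WithLp.prod_continuous_toLp 1 ℝ E).comp
    (continuous_const.prodMk ?_)
  induction t using Fin.cases with
  | zero => exact continuous_apply 0
  | succ s => exact (continuous_apply s.succ).sub (continuous_apply s.castSucc)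

theorem AdmissibleNorm.norm_signatureSeq_le {T : ℕ} {E : Type u} [NormedAddCommGroup E]
    [NormedSpace ℝ E] (N : AdmissibleNorm (TimeExt E)) (x : Fin (T + 1) → E) (m : ℕ) :
    N.norm m (signatureSeq x m) ≤ (∑ t, ‖timeIncrement x t‖) ^ m / m.factorial := by
  have h := N.norm_foldr_tensorExp_le (List.ofFn (timeIncrement x)) m
  rwa [List.map_ofFn, List.map_ofFn, List.sum_ofFn] at h

theorem continuous_signature {T : ℕ} {E : Type u} [NormedAddCommGroup E] [NormedSpace ℝ E]
    (N : AdmissibleNorm (TimeExt E)) :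
    Continuous fun x : Fin (T + 1) → E => signature N x := by
  refine continuous_iff_continuousAt.2 fun x₀ => ?_
  let R (x : Fin (T + 1) → E) : ℝ := ∑ t, ‖timeIncrement x t‖
  have continuous_R : Continuous R := continuous_finsetSum _ fun t _ =>
    ((continuous_apply t).comp continuous_timeIncrement).norm
  refine continuousAt_lp_one (b := fun m => (R x₀ + 1) ^ m / m.factorial) (fun m => ?_)
    (Real.summable_pow_div_factorial _) ?_
  · exact ((UniformSpace.Completion.continuous_coe (NormedTensorPower N m)).comp
      (componentwiseContinuous_foldr_tensorExp (N := N) continuous_timeIncrement m)).continuousAt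
  · filter_upwards [continuous_R.continuousAt.eventually (gt_mem_nhds (lt_add_one (R x₀)))]
      with x hx m
    calc ‖toCompletedTensorPower N m (signatureSeq x m)‖
        = N.norm m (signatureSeq x m) := norm_toCompletedTensorPower N m _
      _ ≤ R x ^ m / m.factorial := N.norm_signatureSeq_le x m
      _ ≤ (R x₀ + 1) ^ m / m.factorial := by gcongr

end Continuity

/-! ### Robust signatures determine measures on path space -/

section MeasureExt

theorem exists_polishSpace_continuous {R E : Type*} [MeasurableSpace R] [StandardBorelSpace R]
    [TopologicalSpace E] [TopologicalSpace.PseudoMetrizableSpace E] {s : R → E}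
    (hs : StronglyMeasurable s) :
    ∃ _ : TopologicalSpace R, PolishSpace R ∧ BorelSpace R ∧ Continuous s := by
  let : MeasurableSpace E := borel E
  have : BorelSpace E := ⟨rfl⟩
  let polish := upgradeStandardBorel R
  have : SecondCountableTopology (range s) := hs.isSeparable_range.secondCountableTopology
  obtain ⟨t, t_le, continuous_s, polish_t⟩ := hs.measurable.exists_continuous
  refine ⟨t, polish_t, ⟨?_⟩, continuous_s⟩
  rw [borel_eq_borel_of_le polish_t polish.toPolishSpace t_le]
  exact eq_borel_upgradeStandardBorel R

theorem measure_ext_of_integral_eq_of_mul_mem_span {Z : Type*} [TopologicalSpace Z] [PolishSpace Z]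
    [MeasurableSpace Z] [BorelSpace Z] {μ ν : Measure Z} [IsFiniteMeasure μ] [IsFiniteMeasure ν]
    {S : Set (Z →ᵇ ℝ)} (one_mem : 1 ∈ Submodule.span ℝ S)
    (mul_mem : ∀ f ∈ S, ∀ g ∈ S, f * g ∈ Submodule.span ℝ S)
    (separates : ∀ x y, (∀ f ∈ S, f x = f y) → x = y)
    (integral_eq : ∀ f ∈ S, ∫ z, f z ∂μ = ∫ z, f z ∂ν) : μ = ν := by
  have mul_mem_span (f g) (hf : f ∈ Submodule.span ℝ S) (hg : g ∈ Submodule.span ℝ S) :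
      f * g ∈ Submodule.span ℝ S := by
    have h := Submodule.mul_mem_mul hf hg
    rw [Submodule.span_mul_span] at h
    exact Submodule.span_le.2 (Set.mul_subset_iff.2 mul_mem) h
  let A : StarSubalgebra ℝ (Z →ᵇ ℝ) :=
    { (Submodule.span ℝ S).toSubalgebra one_mem mul_mem_span with
      star_mem' := fun {f} hf => by
        rwa [show star f = f from BoundedContinuousFunction.ext fun _ => rfl] }
  refine ext_of_forall_mem_subalgebra_integral_eq_of_polish (𝕜 := ℝ) (A := A) ?_ fun g hg => ?_
  · intro x y hxy
    by_contra! eq_on_A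
    exact hxy (separates x y fun f hf =>
      eq_on_A _ ⟨_, ⟨f, Submodule.subset_span hf, rfl⟩, rfl⟩)
  · change g ∈ Submodule.span ℝ S at hg
    induction hg using Submodule.span_induction with
    | mem f hf => exact integral_eq f hf
    | zero => simp
    | add f g _ _ hf hg =>
      simp only [BoundedContinuousFunction.coe_add, Pi.add_apply]
      rw [integral_add (f.integrable μ) (g.integrable μ),
        integral_add (f.integrable ν) (g.integrable ν), hf, hg]
    | smul c f _ hf =>
      simp only [BoundedContinuousFunction.coe_smul]
      rw [integral_smul, integral_smul, hf]

end MeasureExt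

section RobustSignature

variable {T : ℕ} {E : Type u} [NormedAddCommGroup E] [NormedSpace ℝ E]

theorem eq_unit_of_wordPairing_nil_eq_one {F : Type u} [NormedAddCommGroup F] [NormedSpace ℝ F]
    {s : (m : ℕ) → ⨂[ℝ]^m F} (h : wordPairing s [] = 1) :
    s 0 = PiTensorProduct.tprod ℝ Fin.elim0 := by
  refine (PiTensorProduct.isEmptyEquiv (R := ℝ) (s := fun _ : Fin 0 => F) (Fin 0)).injective ?_
  exact h.trans (PiTensorProduct.isEmptyEquiv_apply_tprod (R := ℝ) (Fin 0) _).symm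

theorem signature_mem_unitScalarPart (N : AdmissibleNorm (TimeExt E)) (x : Fin (T + 1) → E) :
    signature N x ∈ unitScalarPart N := by
  refine congrArg (toCompletedTensorPower N 0) (eq_unit_of_wordPairing_nil_eq_one ?_)
  rw [wordPairing_signatureSeq]
  exact (isShuffleCharacter_wordSig _).nil

variable {N : AdmissibleNorm (TimeExt E)} (L : TensorNormalization N)

/-- The normalized signature of a path. -/
def robustSignature (x : Fin (T + 1) → E) : CompletedTensorAlgebra N := L.toFun (signature N x)

theorem continuous_robustSignature :
    Continuous (robustSignature L : (Fin (T + 1) → E) → CompletedTensorAlgebra N) :=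
  L.continuousOn.comp_continuous (continuous_signature N) (signature_mem_unitScalarPart N)

theorem exists_norm_robustSignature_le :
    ∃ K : ℝ, ∀ x : Fin (T + 1) → E, ‖robustSignature L x‖ ≤ K := by
  obtain ⟨K, hK⟩ := L.bounded
  exact ⟨K, fun x => hK _ (signature_mem_unitScalarPart N x)⟩

theorem wordDual_robustSignature (w : List (StrongDual ℝ (TimeExt E))) (x : Fin (T + 1) → E) :
    wordDual N w (robustSignature L x) =
      L.scale (signature N x) ^ w.length * wordPairing (signatureSeq x) w := by
  rw [wordDual_apply, robustSignature, L.apply_eq _ (signature_mem_unitScalarPart N x), map_smul,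
    smul_eq_mul]
  exact congrArg _ (completedWordFunctional_coe N w w.length (signatureSeq x w.length))

theorem isShuffleCharacter_wordDual_robustSignature (x : Fin (T + 1) → E) :
    IsShuffleCharacter fun w => wordDual N w (robustSignature L x) := by
  simp only [wordDual_robustSignature, wordPairing_signatureSeq]
  exact (isShuffleCharacter_wordSig _).dilate _

theorem scale_eq_of_wordDual_time_eq {x y : Fin (T + 1) → E}
    (h : wordDual N [WithLp.fstL 1 ℝ ℝ E] (robustSignature L x) =
      wordDual N [WithLp.fstL 1 ℝ ℝ E] (robustSignature L y)) :
    L.scale (signature N x) = L.scale (signature N y) := by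
  simp only [wordDual_robustSignature, wordPairing_signatureSeq_time, List.length_singleton,
    pow_one] at h
  exact mul_right_cancel₀ (by positivity) h

theorem eq_of_forall_wordDual_robustSignature_eq {x y : Fin (T + 1) → E}
    (h : ∀ w, wordDual N w (robustSignature L x) = wordDual N w (robustSignature L y)) : x = y := by
  have scale_eq := scale_eq_of_wordDual_time_eq L (h _)
  refine eq_of_wordPairing_signatureSeq_eq (funext fun w => ?_)
  have hw := h w
  rw [wordDual_robustSignature, wordDual_robustSignature, scale_eq] at hw
  exact mul_left_cancel₀
    (pow_ne_zero _ (L.scale_pos _ (signature_mem_unitScalarPart N y)).ne') hw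

section WordBCF

variable {Z : Type*} [TopologicalSpace Z]

/-- The linear functional of the robust signature given by a word, as a bounded continuous function
of the parameter of a continuous family of paths. -/
def wordBCF (φ : C(Z, Fin (T + 1) → E)) (w : List (StrongDual ℝ (TimeExt E))) : Z →ᵇ ℝ :=
  BoundedContinuousFunction.ofNormedAddCommGroup
    (fun z => wordDual N w (robustSignature L (φ z)))
    ((wordDual N w).continuous.comp ((continuous_robustSignature L).comp φ.continuous))
    (‖wordDual N w‖ * (exists_norm_robustSignature_le (T := T) L).choose)
    fun _ => (wordDual N w).le_opNorm_of_le
      ((exists_norm_robustSignature_le (T := T) L).choose_spec _)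

theorem wordBCF_nil (φ : C(Z, Fin (T + 1) → E)) : wordBCF L φ [] = 1 := by
  ext z
  exact (isShuffleCharacter_wordDual_robustSignature L (φ z)).nil

theorem wordBCF_mul (φ : C(Z, Fin (T + 1) → E)) (p q : List (StrongDual ℝ (TimeExt E))) :
    wordBCF L φ p * wordBCF L φ q = ((shuffle p q).map (wordBCF L φ)).sum := by
  ext z
  have sum_apply := map_multiset_sum (BoundedContinuousFunction.evalCLM ℝ z).toLinearMap
    ((shuffle p q).map (wordBCF L φ))
  rw [Multiset.map_map] at sum_apply
  exact ((isShuffleCharacter_wordDual_robustSignature L (φ z)).mul p q).trans sum_apply.symm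

theorem measure_ext_of_integral_wordDual [PolishSpace Z] [MeasurableSpace Z] [BorelSpace Z]
    {φ : C(Z, Fin (T + 1) → E)} (hφ : Function.Injective φ) {μ ν : Measure Z} [IsFiniteMeasure μ]
    [IsFiniteMeasure ν]
    (h : ∀ w, ∫ z, wordDual N w (robustSignature L (φ z)) ∂μ =
      ∫ z, wordDual N w (robustSignature L (φ z)) ∂ν) : μ = ν := by
  have wordBCF_mem (w) : wordBCF L φ w ∈ Submodule.span ℝ (range (wordBCF L φ)) :=
    Submodule.subset_span (mem_range_self w)
  refine measure_ext_of_integral_eq_of_mul_mem_span (S := range (wordBCF L φ))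
    (wordBCF_nil L φ ▸ wordBCF_mem []) ?_ (fun x y hxy => ?_) (forall_mem_range.2 h)
  · rintro _ ⟨p, rfl⟩ _ ⟨q, rfl⟩
    rw [wordBCF_mul]
    refine multiset_sum_mem _ fun f hf => ?_
    obtain ⟨w, -, rfl⟩ := Multiset.mem_map.1 hf
    exact wordBCF_mem w
  · exact hφ (eq_of_forall_wordDual_robustSignature_eq L (forall_mem_range.1 hxy))

end WordBCF

variable {R : Type*} [MeasurableSpace R] [StandardBorelSpace R] {s : R → E}

theorem stronglyMeasurable_robustSignature_comp (hs : StronglyMeasurable s) :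
    StronglyMeasurable fun x : Fin (T + 1) → R => robustSignature L fun t => s (x t) := by
  obtain ⟨_, _, _, continuous_s⟩ := exists_polishSpace_continuous hs
  exact ((continuous_robustSignature L).comp (by fun_prop)).stronglyMeasurable

theorem integrable_robustSignature_comp (hs : StronglyMeasurable s)
    (μ : Measure (Fin (T + 1) → R)) [IsFiniteMeasure μ] :
    Integrable (fun x => robustSignature L fun t => s (x t)) μ := by
  obtain ⟨K, hK⟩ := exists_norm_robustSignature_le (T := T) L
  exact Integrable.of_bound (stronglyMeasurable_robustSignature_comp L hs).aestronglyMeasurable K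
    (Eventually.of_forall fun _ => hK _)

theorem measure_ext_of_integral_robustSignature (hs : StronglyMeasurable s)
    (hinj : Function.Injective s) {μ ν : Measure (Fin (T + 1) → R)} [IsFiniteMeasure μ]
    [IsFiniteMeasure ν]
    (h : ∫ x, robustSignature L (fun t => s (x t)) ∂μ =
      ∫ x, robustSignature L (fun t => s (x t)) ∂ν) : μ = ν := by
  obtain ⟨_, _, _, continuous_s⟩ := exists_polishSpace_continuous hs
  let φ : C(Fin (T + 1) → R, Fin (T + 1) → E) := ⟨fun x t => s (x t), by fun_prop⟩
  refine measure_ext_of_integral_wordDual L (φ := φ) hinj.comp_left fun w => ?_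
  calc ∫ x, wordDual N w (robustSignature L (φ x)) ∂μ
      = wordDual N w (∫ x, robustSignature L (φ x) ∂μ) :=
        ContinuousLinearMap.integral_comp_comm _ (integrable_robustSignature_comp L hs μ)
    _ = wordDual N w (∫ x, robustSignature L (φ x) ∂ν) := congrArg _ h
    _ = ∫ x, wordDual N w (robustSignature L (φ x)) ∂ν :=
        (ContinuousLinearMap.integral_comp_comm _ (integrable_robustSignature_comp L hs ν)).symm

end RobustSignature

/-! ### Robust expected signatures of higher rank -/

section RobustExpSig

variable {T : ℕ} {V : Type u} [NormedAddCommGroup V] [NormedSpace ℝ V] [CompleteSpace V]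
  [TopologicalSpace.SeparableSpace V] [MeasurableSpace V] [BorelSpace V]
  {N : TensorNormSystem.{u}} (L : RankNormalization N V)

theorem stronglyMeasurable_robustExpSig (r : ℕ) :
    StronglyMeasurable (robustExpSig L r : RankProb T V r → RankTensor N V r) := by
  induction r with
  | zero =>
    have := UniformSpace.secondCountable_of_separable V
    exact (stronglyMeasurable_id : StronglyMeasurable (id : V → V))
  | succ r ih =>
    exact RankProb.stronglyMeasurable_integral
      (E := CompletedTensorAlgebra (N (TimeExt (RankTensor N V r))))
      (stronglyMeasurable_robustSignature_comp (T := T) (L r) ih)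

theorem robustExpSig_injective (r : ℕ) :
    Function.Injective (robustExpSig L r : RankProb T V r → RankTensor N V r) := by
  induction r with
  | zero => exact fun _ _ h => h
  | succ r ih =>
    exact fun _ _ h => RankProb.toMeasure_injective (measure_ext_of_integral_robustSignature (L r)
      (stronglyMeasurable_robustExpSig L r) ih h)

end RobustExpSig

end

theorem theorem4p4 {V : Type u} [NormedAddCommGroup V] [NormedSpace ℝ V] [CompleteSpace V]
    [TopologicalSpace.SeparableSpace V] [MeasurableSpace V] [BorelSpace V]
    (N : TensorNormSystem.{u}) (L : RankNormalization N V) (T : ℕ)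
    (X : AdaptedProcess.{u, v} T V) (Y : AdaptedProcess.{u, w} T V) (r : ℕ) :
    List.TFAE [
      ∀ f : AdaptedFunctional T V, f.rank ≤ r →
        ∫ ω, f.eval X ω ∂X.P = ∫ ω, f.eval Y ω ∂Y.P,
      X.predictionLaw r = Y.predictionLaw r,
      X.jointPredictionLaw r = Y.jointPredictionLaw r,
      adaptedSig L r X = adaptedSig L r Y] := by
  tfae_have 1 ↔ 2 := AdaptedFunctional.forall_integral_eval_eq_iff_predictionLaw_eq X Y r
  tfae_have 3 ↔ 2 := AdaptedProcess.jointPredictionLaw_eq_iff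
  tfae_have 4 ↔ 2 := (robustExpSig_injective L (r + 1)).eq_iff
  tfae_finish
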